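/- Let $F$ be a number field with ring of adeles $\mathbb{A}$, let $n\ge 1$, $G=GL(n)$ and $g\in G(\mathbb{A})$. A standard parabolic subgroup $P$ of $G$ is the group of block upper triangular matrices of a given type $(n_1,\dots,n_r)$, a composition of $n$; it is called extremal if $r\le 2$, that is, if $P$ is $G$ or maximal. Let $K\subset G(\mathbb{A})$ be the standard maximal compact subgroup. Let $H_P:G(\mathbb{A})\to a_P\subset\mathbb{R}^n$ be the Harish-Chandra map: if $g=pk$ with $p\in P(\mathbb{A})$, $k\in K$, and $p$ has diagonal blocks $p_1,\dots,p_r$, then the coordinates of $H_P(g)$ in the $k$-th block are all equal to $\frac{1}{n_k}\log|\det p_k|_{\mathbb{A}}$. Put $\varpi_P=\frac1{n_1}(1,\dots,1,0,\dots,0)$, with $n_1$ ones. For standard parabolic subgroups $P\subset Q$, let $\rho_P^Q$ be half the sum of the roots of the diagonal torus in $N_P\cap M_Q$, and put $\deg_i^Q(g)=\sup\langle\rho_P^Q,H_P(\delta g)\rangle$, over all standard $P\subset Q$ and $\delta\in P(F)\backslash Q(F)$. A pair $(P,\delta)$, with $P$ standard and $\delta\in P(F)\backslash G(F)$, is canonical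 for $g$ if $\langle\rho_P^G,H_P(\delta g)\rangle=\deg_i^G(g)$ and $P$ is the only parabolic subgroup $Q\supset P$ with $\langle\rho_Q^G,H_Q(\delta g)\rangle=\deg_i^G(g)$. There is exactly one canonical pair for $g$. Finally put $$E^G(g)=\sum_P\sum_{\delta\in P(F)\backslash G(F)}F^P(\delta g)\,\tau_P^G(H_P(\delta g))\,\chi_P^G(H_P(\delta g)),$$ where $P$ runs over the standard parabolic subgroups, $F^P$ is the characteristic function of $\{\deg_i^P\le 0\}$, $\tau_P^G$ that of $\{H:\langle\alpha,H\rangle>0\text{ for every simple root }\alpha\in\Delta_P\}$, and $\chi_P^G$ that of $\{H:\langle\varpi_P,H\rangle\le 0\}$. Then: 1. The supremum of $\langle\varpi_P,H_P(\delta g)\rangle$ over the pairs $(P,\delta)$ formed of an extremal parabolic subgroup $P$ and an element $\delta\in P(F)\backslash G(F)$ is finite and attained. 2. Let $P$ be the extremal parabolic subgroup with the largest first block $n_1$ for which there is a $\delta\in P(F)\backslash G(F)$ such that $(P,\delta)$ attains this supremum. Then $\delta$ is unique. More precisely, let $(Q,\gamma)$ be the canonical pair for $g$ and $(n_1,\dots,n_r)$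 the type of $Q$. Then $P$ is of type $(n_1,n_2+\dots+n_r)$ (that is, $P=G$ if $r=1$), and $\delta$ is the projection of $\gamma$ to $P(F)\backslash G(F)$. 3. $E^G(g)=1$ if and only if $\langle\varpi_P,H_P(\delta g)\rangle\le 0$ for every extremal $P$ and every $\delta\in P(F)\backslash G(F)$. -/

import Mathlib

open NumberField IsDedekindDomain Matrix
open scoped ENNReal MatrixGroups

noncomputable section

namespace AdelicGL

/-! ### Adeles of a number field -/

/-- The adele ring of the number field `F`. -/
abbrev Adele (F : Type*) [Field F] [NumberField F] : Type _ := AdeleRing (𝓞 F) F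

/-- The projection from the adeles to the completion at an infinite place `v`. -/
def toInf (F : Type*) [Field F] [NumberField F] (v : InfinitePlace F) :
    Adele F →+* v.Completion where
  toFun x := x.1 v
  map_one' := rfl
  map_mul' _ _ := rfl
  map_zero' := rfl
  map_add' _ _ := rfl

/-- The projection from the adeles to the completion at a finite place `v`. -/
def toFin (F : Type*) [Field F] [NumberField F] (v : HeightOneSpectrum (𝓞 F)) :
    Adele F →+* v.adicCompletion F where
  toFun x := x.2 v
  map_one' := rfl
  map_mul' _ _ := rfl
  map_zero' := rfl
  map_add' _ _ := rfl

/-- The adelic absolute value: the product over all places of the normalised absolute values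
(the usual one at a real place, its square at a complex place, and at a finite place the one for
which a uniformiser has absolute value the inverse of the cardinality of the residue field).
It is only used on ideles, where almost all factors are `1`. -/
def adelicAbs {F : Type*} [Field F] [NumberField F] (x : Adele F) : ℝ :=
  (∏ v : InfinitePlace F, ‖toInf F v x‖ ^ v.mult) *
    ∏ᶠ v : HeightOneSpectrum (𝓞 F), ‖toFin F v x‖

/-! ### `GL(n)`, its standard parabolic subgroups and its standard maximal compact subgroup

The standard parabolic subgroups of `GL(n)` (those containing the upper triangular Borel
subgroup) are the groups of block upper triangular matrices; they are indexed by their type,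
a composition `(n₁, …, n_r)` of `n`. -/

/-- The group `P(R)` of `R`-points of the standard parabolic subgroup `P` of the given type. -/
def parabolic {n : ℕ} (P : Composition n) (R : Type*) [CommRing R] :
    Subgroup (GL (Fin n) R) where
  carrier := {g | (g : Matrix (Fin n) (Fin n) R).BlockTriangular P.index}
  one_mem' := by simpa using Matrix.blockTriangular_one
  mul_mem' := by
    intro a b ha hb
    simpa using Matrix.BlockTriangular.mul ha hb
  inv_mem' := by
    intro a ha
    have : Invertible (a : Matrix (Fin n) (Fin n) R) := a.isUnit.invertible
    have h := Matrix.blockTriangular_inv_of_blockTriangular ha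
    simpa [Matrix.coe_units_inv] using h

/-- The type of `G = GL(n)`, seen as a parabolic subgroup of itself. -/
def whole (n : ℕ) [NeZero n] : Composition n := Composition.single n (NeZero.pos n)

/-- The embedding of `G(F)` in `G(𝔸)`. -/
def rat {F : Type*} [Field F] [NumberField F] {n : ℕ} :
    GL (Fin n) F →* GL (Fin n) (Adele F) :=
  Matrix.GeneralLinearGroup.map (algebraMap F (Adele F))

/-- The standard maximal compact subgroup `K` of `G(𝔸)`: its component is in `GL(n, O_v)` at a
finite place `v`, in `O(n)` at a real place and in `U(n)` at a complex place. (A completion at an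
infinite place is embedded in `ℂ`; the unitary matrices with real entries are the orthogonal
ones.) -/
def maxCompact (F : Type*) [Field F] [NumberField F] (n : ℕ) :
    Subgroup (GL (Fin n) (Adele F)) :=
  (⨅ v : InfinitePlace F,
      (Unitary.toUnits (R := Matrix (Fin n) (Fin n) ℂ)).range.comap
        (Matrix.GeneralLinearGroup.map
          ((InfinitePlace.Completion.extensionEmbedding v).comp (toInf F v)))) ⊓
    ⨅ v : HeightOneSpectrum (𝓞 F),
      (Matrix.GeneralLinearGroup.map (n := Fin n) (v.adicCompletionIntegers F).subtype).range.comap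
        (Matrix.GeneralLinearGroup.map (toFin F v))

/-! ### The Harish-Chandra map

The space `a_0` is `ℝ^n`, and `a_P` is embedded in it as the vectors that are constant on the
blocks of `P`. Linear forms on `a_0` are also vectors of `ℝ^n`, and the pairing is the
dot product. -/

/-- For `p ∈ P(𝔸)`, the element of `a_P` on which each rational character `χ` of `P` takes the
value `log |χ(p)|`. In the `k`-th block all coordinates are `(log |det p_k|) / n_k`, where `p_k` is
the `k`-th diagonal block of `p`, so that the character `det p_k` has the value `log |det p_k|`. -/
def parabolicLog {F : Type*} [Field F] [NumberField F] {n : ℕ} (P : Composition n)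
    (p : GL (Fin n) (Adele F)) : Fin n → ℝ := fun i =>
  Real.log (adelicAbs
      ((p : Matrix (Fin n) (Fin n) (Adele F)).toSquareBlock P.index (P.index i)).det) /
    (P.blocksFun (P.index i) : ℝ)

open Classical in
/-- The Harish-Chandra map `H_P : G(𝔸) → a_P`: if `g = p k` is an Iwasawa decomposition of `g`,
with `p ∈ P(𝔸)` and `k ∈ K`, then `H_P(g) = H_P(p)`. -/
def harishChandra {F : Type*} [Field F] [NumberField F] {n : ℕ} (P : Composition n)
    (g : GL (Fin n) (Adele F)) : Fin n → ℝ :=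
  if h : ∃ p ∈ parabolic P (Adele F), ∃ k ∈ maxCompact F n, g = p * k then
    parabolicLog P h.choose
  else 0

/-! ### Degree of instability and canonical pairs

An element of `P(F) \ G(F)` is represented by an element `δ` of `G(F)`. Two elements `δ`, `δ'`
represent the same one if and only if `δ' δ⁻¹ ∈ P(F)`. All that is below depends on `δ` only
through its class, since `H_P` is left invariant under `P(F)`. -/

/-- `ρ_P^Q`: half the sum of the roots `e_i - e_j` of the diagonal torus in `N_P ∩ M_Q`. -/
def rho {n : ℕ} (P Q : Composition n) : Fin n → ℝ :=
  (1 / 2 : ℝ) • ∑ i : Fin n, ∑ j : Fin n,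
    if P.index i < P.index j ∧ Q.index i = Q.index j then
      (Pi.single i 1 - Pi.single j 1 : Fin n → ℝ) else 0

/-- The degree of instability `deg_i^Q(g)`, the supremum of `⟨ρ_P^Q, H_P(δ g)⟩` over the standard
parabolic subgroups `P ⊆ Q` and `δ ∈ P(F) \ Q(F)`. -/
def instabilityDegree {F : Type*} [Field F] [NumberField F] {n : ℕ} (Q : Composition n)
    (g : GL (Fin n) (Adele F)) : EReal :=
  ⨆ (P : Composition n) (_ : parabolic P F ≤ parabolic Q F) (δ : parabolic Q F),
    ((rho P Q ⬝ᵥ harishChandra P (rat (δ : GL (Fin n) F) * g) : ℝ) : EReal)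

/-- The pair `(P, δ)` is canonical for `g`: it reaches the degree of instability of `g`, and no
`(Q, δ)` with `Q` strictly larger than `P` does. -/
def IsCanonical {F : Type*} [Field F] [NumberField F] {n : ℕ} [NeZero n]
    (P : Composition n) (δ : GL (Fin n) F) (g : GL (Fin n) (Adele F)) : Prop :=
  ((rho P (whole n) ⬝ᵥ harishChandra P (rat δ * g) : ℝ) : EReal) =
      instabilityDegree (whole n) g ∧
    ∀ Q : Composition n, parabolic P F ≤ parabolic Q F →
      ((rho Q (whole n) ⬝ᵥ harishChandra Q (rat δ * g) : ℝ) : EReal) =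
        instabilityDegree (whole n) g →
      Q = P

/-! ### Extremal parabolic subgroups and slopes -/

/-- The first entry `n₁` of the type `(n₁, …, n_r)` of `P`. -/
def firstPart {n : ℕ} (P : Composition n) : ℕ := P.sizeUpTo 1

/-- The weight `ϖ_P = (1 / n₁) (1, …, 1, 0, …, 0)`, with `n₁` ones, of a standard parabolic
subgroup `P` of type `(n₁, …, n_r)`. -/
def varpi {n : ℕ} (P : Composition n) : Fin n → ℝ := fun i =>
  if (i : ℕ) < firstPart P then (1 / firstPart P : ℝ) else 0

/-- `P` is extremal: it is `G` (one block) or a maximal parabolic subgroup (two blocks). -/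
def IsExtremal {n : ℕ} (P : Composition n) : Prop := P.length = 1 ∨ P.length = 2

/-- `⟨ϖ_P, H_P(δ g)⟩`. -/
def slope {F : Type*} [Field F] [NumberField F] {n : ℕ} (P : Composition n)
    (δ : GL (Fin n) F) (g : GL (Fin n) (Adele F)) : ℝ :=
  varpi P ⬝ᵥ harishChandra P (rat δ * g)

/-- The set of the `⟨ϖ_P, H_P(δ g)⟩`, for `P` extremal and `δ ∈ P(F) \ G(F)`. -/
def extremalSlopes {F : Type*} [Field F] [NumberField F] {n : ℕ}
    (g : GL (Fin n) (Adele F)) : Set ℝ :=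
  {s | ∃ (P : Composition n) (δ : GL (Fin n) F), IsExtremal P ∧ s = slope P δ g}

/-- `P` is extremal and the pair `(P, δ)` reaches the supremum of the `⟨ϖ_P, H_P(δ g)⟩`. -/
def AttainsSup {F : Type*} [Field F] [NumberField F] {n : ℕ} (P : Composition n)
    (δ : GL (Fin n) F) (g : GL (Fin n) (Adele F)) : Prop :=
  IsExtremal P ∧ IsGreatest (extremalSlopes g) (slope P δ g)

/-! ### The truncation function -/

/-- The set whose characteristic function is `F^P`: the `g` with `deg_i^P(g) ≤ 0`. -/
def semistableSet {n : ℕ} (F : Type*) [Field F] [NumberField F] (P : Composition n) :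
    Set (GL (Fin n) (Adele F)) :=
  {g | instabilityDegree P g ≤ 0}

/-- The linear form `H ↦` mean of the coordinates of `H` in the `k`-th block of `P`. -/
def blockMean {n : ℕ} (P : Composition n) (k : Fin P.length) : Fin n → ℝ := fun i =>
  if P.index i = k then (1 / P.blocksFun k : ℝ) else 0

/-- The set `Δ_P` of simple roots of `P`. On `a_P` (vectors constant on the blocks) these are the
restrictions of the simple roots `e_i - e_{i+1}` that are not roots of the Levi subgroup. -/
def simpleRoots {n : ℕ} (P : Composition n) : Set (Fin n → ℝ) :=
  {α | ∃ k l : Fin P.length, (l : ℕ) = k + 1 ∧ α = blockMean P k - blockMean P l}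

/-- The open cone with characteristic function `τ_P^G`. -/
def positiveCone {n : ℕ} (P : Composition n) : Set (Fin n → ℝ) :=
  {H | ∀ α ∈ simpleRoots P, 0 < α ⬝ᵥ H}

/-- The half-space with characteristic function `χ_P^G`. -/
def slopeHalfSpace {n : ℕ} (P : Composition n) : Set (Fin n → ℝ) :=
  {H | varpi P ⬝ᵥ H ≤ 0}

/-- The truncation function
`E^G(g) = ∑_P ∑_{δ ∈ P(F) \ G(F)} F^P(δ g) τ_P^G(H_P(δ g)) χ_P^G(H_P(δ g))`,
where `P` runs over the standard parabolic subgroups. The sum is taken in `[0, ∞]`, where it always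
makes sense, and each class `δ` is represented by one of its elements. -/
def truncation {F : Type*} [Field F] [NumberField F] {n : ℕ}
    (g : GL (Fin n) (Adele F)) : ℝ≥0∞ :=
  ∑ P : Composition n, ∑' δ : Quotient (QuotientGroup.rightRel (parabolic P F)),
    (semistableSet F P).indicator 1 (rat δ.out * g) *
      (positiveCone P).indicator 1 (harishChandra P (rat δ.out * g)) *
      (slopeHalfSpace P).indicator 1 (harishChandra P (rat δ.out * g))

end AdelicGL

end

open NumberField IsDedekindDomain Matrix
open scoped ENNReal MatrixGroups

noncomputable section

namespace AdelicGL

variable {F : Type*} [Field F] [NumberField F]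

/-! ### The adelic absolute value -/

/-! A class `δ` modulo `P(F)` is a flag in `F^n`: the spans of the rows of `δ` from each partial sum
of `P` on (`mem_parabolic_iff`). Let `f(W)` be the logarithm of the covolume of the whole space
minus that of `W`, both taken relative to `g` (`quotHeight`). Then `H_P(δ g)` is the vector of
slopes of `f` along the flag (`harishChandra_eq`). Beyond this the adeles enter only through two
facts: `f` is supermodular (`quotHeight_add_le`) and bounded above (`quotHeight_bddAbove`). The
first rests on the Iwasawa decomposition, the product formula and the bound 1 for minors of elements
of `K` (`adelicAbs_minor_le`); the second follows from the first.

The rest is Harder–Narasimhan theory for such an `f`. There is a flag with semistable steps and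
strictly decreasing slopes (`exists_HNChain`). Its concave polygon bounds `f` as a function of
codimension, and each vertex has a support line met by no other subspace (`HNChain.exists_support`).

The pairing of `ρ_P^Q` with `H_P(δ g)` is a difference of areas under polygons
(`Refines.rho_dotProduct_slopeVec`), so the canonical pair is the flag of largest area with fewest
steps, that is, the Harder–Narasimhan flag. The pairing with `ϖ_P` is the slope of a chord from the
origin; its maximum is the first slope of that flag, and the first vertex is the farthest point that
reaches it. Finally, `F^P` and `τ_P` are both nonzero exactly on the Harder–Narasimhan flag
(`isHNPair_iff`), so `E^G(g)` has a single candidate term, and `χ_P` tests the sign of the first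
slope. -/

lemma norm_le_one_iff_mem_integers {v : HeightOneSpectrum (𝓞 F)} (x : v.adicCompletion F) :
    ‖x‖ ≤ 1 ↔ x ∈ v.adicCompletionIntegers F := by
  rw [HeightOneSpectrum.mem_adicCompletionIntegers]
  exact Valued.toNormedField.norm_le_one_iff

lemma eventually_toFin_mem (x : Adele F) :
    ∀ᶠ v : HeightOneSpectrum (𝓞 F) in Filter.cofinite,
      toFin F v x ∈ v.adicCompletionIntegers F := x.2.2

/-- An idele and its inverse are both integral at almost every place, so the norm is 1 there.
Without this, `finprod` could take its default value 1 and multiplicativity would fail. -/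
lemma hasFiniteMulSupport_norm_toFin {x : Adele F} (hx : IsUnit x) :
    Function.HasFiniteMulSupport fun v : HeightOneSpectrum (𝓞 F) => ‖toFin F v x‖ := by
  obtain ⟨u, rfl⟩ := hx
  have h1 := eventually_toFin_mem (u : Adele F)
  have h2 := eventually_toFin_mem ((u⁻¹ : (Adele F)ˣ) : Adele F)
  have h3 : ∀ᶠ v : HeightOneSpectrum (𝓞 F) in Filter.cofinite, ‖toFin F v u‖ = 1 := by
    filter_upwards [h1, h2] with v ha hb
    rw [← norm_le_one_iff_mem_integers] at ha hb
    have h4 : ‖toFin F v u‖ * ‖toFin F v ((u⁻¹ : (Adele F)ˣ) : Adele F)‖ = 1 := by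
      rw [← norm_mul, ← map_mul]; simp
    nlinarith [norm_nonneg (toFin F v (u : Adele F)),
      norm_nonneg (toFin F v ((u⁻¹ : (Adele F)ˣ) : Adele F))]
  exact h3

lemma adelicAbs_mul {x y : Adele F} (hx : IsUnit x) (hy : IsUnit y) :
    adelicAbs (x * y) = adelicAbs x * adelicAbs y := by
  simp only [adelicAbs, map_mul, norm_mul, mul_pow, Finset.prod_mul_distrib]
  rw [finprod_mul_distrib (hasFiniteMulSupport_norm_toFin hx) (hasFiniteMulSupport_norm_toFin hy)]
  ring

lemma adelicAbs_one : adelicAbs (1 : Adele F) = 1 := by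
  simp [adelicAbs]

lemma adelicAbs_nonneg (x : Adele F) : 0 ≤ adelicAbs x :=
  mul_nonneg (Finset.prod_nonneg fun _ _ => pow_nonneg (norm_nonneg _) _)
    (finprod_nonneg fun _ => norm_nonneg _)

lemma adelicAbs_pos {x : Adele F} (hx : IsUnit x) : 0 < adelicAbs x := by
  obtain ⟨u, rfl⟩ := hx
  have h : adelicAbs (u : Adele F) * adelicAbs ((u⁻¹ : (Adele F)ˣ) : Adele F) = 1 := by
    rw [← adelicAbs_mul u.isUnit (u⁻¹).isUnit]
    simp [adelicAbs_one]
  exact (adelicAbs_nonneg _).lt_of_ne' fun h0 => by simp [h0] at h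

lemma adelicAbs_le_one {x : Adele F} (h₁ : ∀ v, ‖toInf F v x‖ ≤ 1) (h₂ : ∀ v, ‖toFin F v x‖ ≤ 1) :
    adelicAbs x ≤ 1 := by
  refine mul_le_one₀ ?_ (finprod_nonneg fun _ => norm_nonneg _) ?_
  · exact Finset.prod_le_one (fun _ _ => pow_nonneg (norm_nonneg _) _)
      fun v _ => pow_le_one₀ (norm_nonneg _) (h₁ v)
  -- The element need not be an idele: the induction also covers the default value 1 of `finprod`.
  · exact (finprod_induction (fun r : ℝ => 0 ≤ r ∧ r ≤ 1) (by simp)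
      (fun a b ha hb => ⟨mul_nonneg ha.1 hb.1, mul_le_one₀ ha.2 hb.1 hb.2⟩)
      fun v => ⟨norm_nonneg _, h₂ v⟩).2

lemma toInf_algebraMap (v : InfinitePlace F) (x : F) :
    ‖toInf F v (algebraMap F (Adele F) x)‖ = v x :=
  InfinitePlace.Completion.norm_coe v (WithAbs.toAbs v.1 x)

lemma toFin_algebraMap (v : HeightOneSpectrum (𝓞 F)) (x : F) :
    ‖toFin F v (algebraMap F (Adele F) x)‖ = FinitePlace.mk v x := rfl

/-- The product formula. -/
lemma adelicAbs_algebraMap {x : F} (hx : x ≠ 0) : adelicAbs (algebraMap F (Adele F) x) = 1 := by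
  rw [← NumberField.prod_abs_eq_one hx]
  simp only [adelicAbs, toInf_algebraMap, toFin_algebraMap]
  congr 1
  exact finprod_eq_of_bijective FinitePlace.mk
    ⟨fun a b h => FinitePlace.mk_eq_iff.1 h, fun w => ⟨w.maximalIdeal, w.mk_maximalIdeal⟩⟩
    fun _ => rfl

/-! ### Minors of elements of the maximal compact subgroup -/

section
open scoped Matrix.Norms.L2Operator

/-- With `S` this matrix, `S Sᴴ = 1`, and the C*-identity bounds the norm. An empty index type is
separate because there the norm of `1` is 0. -/
lemma l2_opNorm_submatrix_one_le {ι κ : Type*} [Fintype ι] [DecidableEq ι] [Fintype κ]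
    [DecidableEq κ] {s : ι → κ} (hs : s.Injective) :
    ‖(1 : Matrix κ κ ℂ).submatrix s id‖ ≤ 1 := by
  have h : ‖((1 : Matrix κ κ ℂ).submatrix s id)ᴴ‖ * ‖((1 : Matrix κ κ ℂ).submatrix s id)ᴴ‖ ≤ 1 := by
    rw [← Matrix.l2_opNorm_conjTranspose_mul_self, conjTranspose_conjTranspose,
      conjTranspose_submatrix, conjTranspose_one, ← submatrix_mul _ _ s id s Function.bijective_id,
      mul_one, submatrix_one _ hs]
    rcases isEmpty_or_nonempty ι with h | h
    · rw [Subsingleton.elim (1 : Matrix ι ι ℂ) 0]; simp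
    · simp
  rw [l2_opNorm_conjTranspose] at h
  nlinarith [norm_nonneg ((1 : Matrix κ κ ℂ).submatrix s id)]

/-- The determinant is the product of the eigenvalues, each bounded by the operator norm. -/
lemma norm_det_le_one_of_l2_opNorm_le_one {ι : Type*} [Fintype ι] [DecidableEq ι]
    {B : Matrix ι ι ℂ} (hB : ‖B‖ ≤ 1) : ‖B.det‖ ≤ 1 := by
  rcases isEmpty_or_nonempty ι with h | h
  · simp
  rw [det_eq_prod_roots_charpoly]
  have key : ∀ z ∈ B.charpoly.roots, ‖z‖ ≤ 1 := fun z hz => by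
    have : z ∈ spectrum ℂ B :=
      Matrix.mem_spectrum_iff_isRoot_charpoly.2 (Polynomial.isRoot_of_mem_roots hz)
    exact (spectrum.norm_le_norm_of_mem this).trans hB
  generalize B.charpoly.roots = S at key
  induction S using Multiset.induction_on with
  | empty => simp
  | cons a S ih =>
    rw [Multiset.prod_cons, norm_mul]
    exact mul_le_one₀ (key a (Multiset.mem_cons_self _ _)) (norm_nonneg _)
      (ih fun z hz => key z (Multiset.mem_cons_of_mem hz))

lemma submatrix_eq_one_mul_mul {ι κ : Type*} [Fintype κ] [DecidableEq κ] (U : Matrix κ κ ℂ)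
    (s t : ι → κ) : U.submatrix s t = (1 : Matrix κ κ ℂ).submatrix s id * U *
      ((1 : Matrix κ κ ℂ).submatrix t id)ᴴ := by
  rw [conjTranspose_submatrix, conjTranspose_one]
  ext i j
  simp only [Matrix.mul_apply, submatrix_apply, Matrix.one_apply, id]
  simp

lemma l2_opNorm_le_one_of_mem_unitaryGroup {κ : Type*} [Fintype κ] [DecidableEq κ]
    {U : Matrix κ κ ℂ} (hU : U ∈ unitaryGroup κ ℂ) : ‖U‖ ≤ 1 := by
  have h1 : Uᴴ * U = 1 := mem_unitaryGroup_iff'.1 hU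
  have := Matrix.l2_opNorm_conjTranspose_mul_self U
  rw [h1] at this
  rcases isEmpty_or_nonempty κ with h | h
  · rw [Subsingleton.elim U 0]; simp
  · rw [norm_one] at this
    nlinarith [norm_nonneg U]

/-- A submatrix of a unitary matrix is its product with two coordinate contractions, hence a
contraction. -/
lemma norm_det_submatrix_le_one {ι κ : Type*} [Fintype ι] [DecidableEq ι] [Fintype κ]
    [DecidableEq κ] {U : Matrix κ κ ℂ} (hU : U ∈ unitaryGroup κ ℂ) {s t : ι → κ}
    (hs : s.Injective) (ht : t.Injective) : ‖(U.submatrix s t).det‖ ≤ 1 := by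
  apply norm_det_le_one_of_l2_opNorm_le_one
  have h1 : ‖((1 : Matrix κ κ ℂ).submatrix t id)ᴴ‖ ≤ 1 := by
    rw [l2_opNorm_conjTranspose]
    exact l2_opNorm_submatrix_one_le ht
  have h2 : ‖(1 : Matrix κ κ ℂ).submatrix s id * U‖ ≤ 1 :=
    (Matrix.l2_opNorm_mul _ _).trans (mul_le_one₀ (l2_opNorm_submatrix_one_le hs)
      (norm_nonneg _) (l2_opNorm_le_one_of_mem_unitaryGroup hU))
  rw [submatrix_eq_one_mul_mul]
  exact (Matrix.l2_opNorm_mul _ _).trans (mul_le_one₀ h2 (norm_nonneg _) h1)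

end

/-- Unitarity at the infinite places, integrality at the finite ones. Apart from this bound, only
the group law of `K` and the Iwasawa decomposition are used. -/
lemma adelicAbs_det_submatrix_le_one {n : ℕ} {k : GL (Fin n) (Adele F)} (hk : k ∈ maxCompact F n)
    {ι : Type*} [Fintype ι] [DecidableEq ι] {s t : ι → Fin n} (hs : s.Injective)
    (ht : t.Injective) :
    adelicAbs ((k : Matrix (Fin n) (Fin n) (Adele F)).submatrix s t).det ≤ 1 := by
  obtain ⟨h₁, h₂⟩ := Subgroup.mem_inf.1 hk
  simp only [Subgroup.mem_iInf, Subgroup.mem_comap, MonoidHom.mem_range] at h₁ h₂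
  refine adelicAbs_le_one (fun v => ?_) fun v => ?_
  · obtain ⟨u, hu⟩ := h₁ v
    rw [← (AddMonoidHomClass.isometry_iff_norm _).1
      (InfinitePlace.Completion.isometry_extensionEmbedding v), ← RingHom.comp_apply,
      RingHom.map_det, RingHom.mapMatrix_apply, ← submatrix_map]
    have : ((k : Matrix (Fin n) (Fin n) (Adele F)).map
        ((InfinitePlace.Completion.extensionEmbedding v).comp (toInf F v))) = (u : Matrix _ _ ℂ) :=
      (congrArg Units.val hu).symm
    rw [this]
    exact norm_det_submatrix_le_one u.2 hs ht
  · obtain ⟨u, hu⟩ := h₂ v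
    have : (k : Matrix (Fin n) (Fin n) (Adele F)).map (toFin F v) =
        (u : Matrix (Fin n) (Fin n) (v.adicCompletionIntegers F)).map
          (v.adicCompletionIntegers F).subtype := (congrArg Units.val hu).symm
    rw [RingHom.map_det, RingHom.mapMatrix_apply, ← submatrix_map, this, submatrix_map,
      ← RingHom.mapMatrix_apply, ← RingHom.map_det, norm_le_one_iff_mem_integers]
    exact Subtype.property _

/-! ### Local Iwasawa decompositions -/

section LocalIwasawa

/-- Gram–Schmidt on the rows of `M`, started from the last row (hence the order dual). The entries
of `M * u` are the inner products of rows with basis vectors. -/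
lemma exists_unitary_mul_isUpperTriangular {𝕜 : Type*} [RCLike 𝕜] {n : ℕ}
    (M : Matrix (Fin n) (Fin n) 𝕜) :
    ∃ u ∈ unitaryGroup (Fin n) 𝕜, (M * u).BlockTriangular id := by
  let f : (Fin n)ᵒᵈ → EuclideanSpace 𝕜 (Fin n) := fun i => WithLp.toLp 2 (M (OrderDual.ofDual i))
  have hc : Module.finrank 𝕜 (EuclideanSpace 𝕜 (Fin n)) = Fintype.card (Fin n)ᵒᵈ := by simp
  let b := InnerProductSpace.gramSchmidtOrthonormalBasis hc f
  let u : Matrix (Fin n) (Fin n) 𝕜 := Matrix.of fun k j => star (b (OrderDual.toDual j) k)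
  have hu : ∀ k j, u k j = star (b (OrderDual.toDual j) k) := fun _ _ => rfl
  refine ⟨u, ?_, ?_⟩
  · rw [mem_unitaryGroup_iff']
    ext i j
    have h := (orthonormal_iff_ite.1 b.orthonormal) (OrderDual.toDual j) (OrderDual.toDual i)
    rw [PiLp.inner_apply] at h
    simp only [RCLike.inner_apply] at h
    simp only [Matrix.mul_apply, star_apply, hu, star_star, Matrix.one_apply]
    simp only [RCLike.star_def]
    rw [h]
    simp [eq_comm]
  · intro i j hij
    have h := InnerProductSpace.gramSchmidtOrthonormalBasis_inv_triangular hc f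
      (i := OrderDual.toDual i) (j := OrderDual.toDual j) hij
    rw [PiLp.inner_apply] at h
    simpa [Matrix.mul_apply, hu, f, b] using h

/-- Column reduction, by induction on the size: a vector killed by all rows but the first is scaled
to a primitive integral vector, which becomes the first column of a matrix in `GL(O)`. -/
lemma exists_GL_mul_isUpperTriangular {K : Type*} [Field K] (O : ValuationSubring K) :
    ∀ (n : ℕ) (M : Matrix (Fin n) (Fin n) K),
      ∃ k : GL (Fin n) O, (M * (k : Matrix (Fin n) (Fin n) O).map O.subtype).BlockTriangular id
  | 0, M => ⟨1, fun i => i.elim0⟩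
  | n + 1, M => by
    -- Replacing row 0 by zero makes the matrix singular, which produces the vector killed by the
    -- other rows.
    obtain ⟨x, hx0, hx⟩ := (Matrix.exists_mulVec_eq_zero_iff (M := M.updateRow 0 0)).2
      (det_eq_zero_of_row_eq_zero 0 (by simp))
    have hx' : ∀ i : Fin n, (M *ᵥ x) i.succ = 0 := fun i => by
      have := congrFun hx i.succ
      simpa [mulVec, updateRow_ne (Fin.succ_ne_zero i)] using this
    obtain ⟨i₀, -, hi₀⟩ := Finset.exists_max_image Finset.univ (fun i => O.valuation (x i))
      Finset.univ_nonempty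
    have hxi : x i₀ ≠ 0 := fun h => hx0 <| funext fun i => by
      have := hi₀ i (Finset.mem_univ i)
      rw [h, map_zero, le_zero_iff, Valuation.zero_iff] at this
      exact this
    have hy : ∀ i, x i / x i₀ ∈ O := fun i => by
      rw [← O.valuation_le_one_iff, map_div₀]
      exact div_le_one_of_le₀ (hi₀ i (Finset.mem_univ i)) zero_le
    let y : Fin (n + 1) → O := fun i => ⟨x i / x i₀, hy i⟩
    -- Column `i₀` of the identity becomes `y`, leaving determinant `y i₀ = 1`; the swap then moves
    -- this column to the front.
    let k₁ : Matrix (Fin (n + 1)) (Fin (n + 1)) O :=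
      ((1 : Matrix (Fin (n + 1)) (Fin (n + 1)) O).updateCol i₀ y).submatrix id (Equiv.swap 0 i₀)
    have hk₁ : IsUnit k₁.det := by
      have h1 : ((1 : Matrix (Fin (n + 1)) (Fin (n + 1)) O).updateCol i₀ y).det = 1 := by
        rw [← cramer_apply, cramer_one]
        exact Subtype.ext (div_self hxi)
      rw [det_permute', h1, mul_one]
      exact (Units.isUnit _).map (Int.castRingHom O)
    have hk₁c : ∀ i, k₁ i 0 = y i := fun i => by simp [k₁]
    let N := M * k₁.map O.subtype
    have hN : ∀ i : Fin n, N i.succ 0 = 0 := fun i => by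
      have : N i.succ 0 = (M *ᵥ x) i.succ / x i₀ := by
        simp only [N, Matrix.mul_apply, map_apply, hk₁c, mulVec, dotProduct, Finset.sum_div, y]
        exact Finset.sum_congr rfl fun j _ => (mul_div_assoc _ _ _).symm
      rw [this, hx', zero_div]
    obtain ⟨k', hk'⟩ := exists_GL_mul_isUpperTriangular O n (N.submatrix Fin.succ Fin.succ)
    let k₂ : Matrix (Fin (n + 1)) (Fin (n + 1)) O :=
      Matrix.of (Fin.cons (Fin.cons 1 0) fun i => Fin.cons 0 ((k' : Matrix (Fin n) (Fin n) O) i))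
    have h00 : k₂ 0 0 = 1 := rfl
    have h0s : ∀ j : Fin n, k₂ 0 j.succ = 0 := fun j => rfl
    have hs0 : ∀ j : Fin n, k₂ j.succ 0 = 0 := fun j => rfl
    have hss : ∀ i j : Fin n, k₂ i.succ j.succ = (k' : Matrix (Fin n) (Fin n) O) i j :=
      fun i j => rfl
    have hk₂ : IsUnit k₂.det := by
      have : k₂.det = (k' : Matrix (Fin n) (Fin n) O).det := by
        rw [det_succ_column_zero, Fin.sum_univ_succ]
        simp only [h00, hs0]
        simp only [Fin.val_zero, pow_zero, mul_one, one_mul, mul_zero, zero_mul, Finset.sum_const_zero, add_zero]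
        rfl
      rw [this]
      exact (isUnit_iff_isUnit_det _).1 k'.isUnit
    refine ⟨GeneralLinearGroup.mk'' (k₁ * k₂) (by rw [det_mul]; exact hk₁.mul hk₂), ?_⟩
    have hmul : M * (k₁ * k₂).map O.subtype = N * k₂.map O.subtype := by
      rw [Matrix.map_mul, ← Matrix.mul_assoc]
    change (M * (k₁ * k₂).map O.subtype).BlockTriangular id
    rw [hmul]
    intro i j hij
    simp only [id] at hij
    obtain ⟨i, rfl⟩ := Fin.exists_succ_eq.2 (Fin.ne_zero_of_lt hij)
    rw [Matrix.mul_apply, Fin.sum_univ_succ, hN, zero_mul, zero_add]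
    cases j using Fin.cases with
    | zero => exact Finset.sum_eq_zero fun l _ => by simp [hs0]
    | succ j =>
      have := hk' (i := i) (j := j) (by simpa using hij)
      rw [Matrix.mul_apply] at this
      exact this

variable {F : Type*} [Field F] [NumberField F]

omit [NumberField F] in
-- The completion is isomorphic to `ℝ` or `ℂ`, where Gram–Schmidt applies; `c` commutes with
-- conjugation, so it carries unitarity over to `ℂ`.
lemma exists_unitary_mul_isUpperTriangular_completion {n : ℕ} (v : InfinitePlace F)
    (M : Matrix (Fin n) (Fin n) v.Completion) :
    ∃ u : Matrix (Fin n) (Fin n) v.Completion,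
      u.map (InfinitePlace.Completion.extensionEmbedding v) ∈ unitaryGroup (Fin n) ℂ ∧
        (M * u).BlockTriangular id := by
  have key : ∀ {𝕜 : Type} [RCLike 𝕜] (e : v.Completion ≃+* 𝕜) (c : 𝕜 →⋆ₐ[ℝ] ℂ),
      (∀ x, c (e x) = InfinitePlace.Completion.extensionEmbedding v x) →
      ∃ u : Matrix (Fin n) (Fin n) v.Completion,
      u.map (InfinitePlace.Completion.extensionEmbedding v) ∈ unitaryGroup (Fin n) ℂ ∧
        (M * u).BlockTriangular id := by
    intro 𝕜 _ e c hc
    obtain ⟨u, hu, hMu⟩ := exists_unitary_mul_isUpperTriangular (M.map e)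
    refine ⟨u.map e.symm, ?_, fun i j hij => e.injective ?_⟩
    · have h1 : (u.map e.symm).map (InfinitePlace.Completion.extensionEmbedding v) = u.map c := by
        ext i j; simp [← hc]
      rw [mem_unitaryGroup_iff] at hu ⊢
      have h2 : star (u.map c) = (star u).map c := by
        ext i j; exact (map_star c _).symm
      rw [h1, h2]
      have h3 := congrArg (fun A : Matrix (Fin n) (Fin n) 𝕜 => A.map (c : 𝕜 →+* ℂ)) hu
      simpa [Matrix.map_mul] using h3
    · rw [map_zero, ← hMu hij, Matrix.mul_apply, Matrix.mul_apply, map_sum]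
      simp
  rcases v.isReal_or_isComplex with hv | hv
  · refine key (RingEquiv.ofBijective _
      (InfinitePlace.Completion.bijective_extensionEmbeddingOfIsReal hv))
      (StarAlgHom.mk (Algebra.ofId ℝ ℂ) fun r => ?_) fun x => ?_
    · exact (Complex.conj_ofReal r).symm
    · exact InfinitePlace.Completion.extensionEmbeddingOfIsReal_apply hv x
  · exact key (InfinitePlace.Completion.ringEquivComplexOfIsComplex hv) (StarAlgHom.id ℝ ℂ)
      fun x => rfl

end LocalIwasawa

/-! ### The Iwasawa decomposition -/

variable {F : Type*} [Field F] [NumberField F]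

lemma adele_ext {x y : Adele F} (h₁ : ∀ v, toInf F v x = toInf F v y)
    (h₂ : ∀ v, toFin F v x = toFin F v y) : x = y :=
  Prod.ext (funext h₁) (Subtype.ext (funext h₂))

/-- The adele with the given components, integral at every finite place. -/
def integralAdele (x : ∀ v : InfinitePlace F, v.Completion)
    (y : ∀ v : HeightOneSpectrum (𝓞 F), v.adicCompletionIntegers F) : Adele F :=
  (x, ⟨fun v => y v, Filter.Eventually.of_forall fun v => (y v).2⟩)

lemma matrix_adele_ext {ι κ : Type*} {A B : Matrix ι κ (Adele F)}
    (h₁ : ∀ v, A.map (toInf F v) = B.map (toInf F v))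
    (h₂ : ∀ v, A.map (toFin F v) = B.map (toFin F v)) : A = B := by
  ext i j
  exact adele_ext (fun v => congrFun (congrFun (h₁ v) i) j)
    fun v => congrFun (congrFun (h₂ v) i) j

/-- The local factors glue because at every finite place they and their inverses are integral. A
triangular `p` serves all standard `P` at once. -/
lemma exists_isUpperTriangular_mul_maxCompact {n : ℕ} (g : GL (Fin n) (Adele F)) :
    ∃ p : GL (Fin n) (Adele F), (p : Matrix (Fin n) (Fin n) (Adele F)).BlockTriangular id ∧
      ∃ k ∈ maxCompact F n, g = p * k := by
  choose u hu hgu using fun v : InfinitePlace F =>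
    exists_unitary_mul_isUpperTriangular_completion v
      ((g : Matrix (Fin n) (Fin n) (Adele F)).map (toInf F v))
  choose k hgk using fun v : HeightOneSpectrum (𝓞 F) =>
    exists_GL_mul_isUpperTriangular (v.adicCompletionIntegers F) n
      ((g : Matrix (Fin n) (Fin n) (Adele F)).map (toFin F v))
  have hdet : ∀ v, IsUnit (u v).det := fun v => by
    have h1 : IsUnit ((u v).map (InfinitePlace.Completion.extensionEmbedding v)).det :=
      (isUnit_iff_isUnit_det _).1 (Unitary.toUnits ⟨_, hu v⟩).isUnit
    rw [← RingHom.mapMatrix_apply, ← RingHom.map_det] at h1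
    exact isUnit_iff_ne_zero.2 fun h => by simp [h] at h1
  let A : Matrix (Fin n) (Fin n) (Adele F) := fun i j =>
    integralAdele (fun v => u v i j) fun v => (k v : Matrix (Fin n) (Fin n) _) i j
  let B : Matrix (Fin n) (Fin n) (Adele F) := fun i j =>
    integralAdele (fun v => (u v)⁻¹ i j) fun v =>
      ((k v)⁻¹ : GL (Fin n) (v.adicCompletionIntegers F)).1 i j
  have hA₁ : ∀ v, A.map (toInf F v) = u v := fun v => rfl
  have hA₂ : ∀ v, A.map (toFin F v) =
    (k v : Matrix (Fin n) (Fin n) _).map (v.adicCompletionIntegers F).subtype := fun v => rfl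
  have hB₁ : ∀ v, B.map (toInf F v) = (u v)⁻¹ := fun v => rfl
  have hB₂ : ∀ v, B.map (toFin F v) =
    ((k v)⁻¹ : GL (Fin n) (v.adicCompletionIntegers F)).1.map
      (v.adicCompletionIntegers F).subtype := fun v => rfl
  have hAB : A * B = 1 := by
    refine matrix_adele_ext (fun v => ?_) fun v => ?_
    · rw [Matrix.map_mul, hA₁, hB₁, mul_nonsing_inv _ (hdet v),
        Matrix.map_one _ (map_zero _) (map_one _)]
    · rw [Matrix.map_mul, hA₂, hB₂, ← Matrix.map_mul, ← Units.val_mul, mul_inv_cancel,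
        Units.val_one, Matrix.map_one _ (map_zero _) (map_one _),
        Matrix.map_one _ (map_zero _) (map_one _)]
  let κ : GL (Fin n) (Adele F) := ⟨A, B, hAB, mul_eq_one_comm.1 hAB⟩
  have hκ : κ ∈ maxCompact F n := by
    refine Subgroup.mem_inf.2 ⟨?_, ?_⟩
    · simp only [Subgroup.mem_iInf, Subgroup.mem_comap, MonoidHom.mem_range]
      exact fun v => ⟨⟨_, hu v⟩, Units.ext rfl⟩
    · simp only [Subgroup.mem_iInf, Subgroup.mem_comap, MonoidHom.mem_range]
      exact fun v => ⟨k v, Units.ext rfl⟩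
  refine ⟨g * κ, fun i j hij => ?_, κ⁻¹, inv_mem hκ, by group⟩
  refine adele_ext (fun v => ?_) fun v => ?_
  · rw [map_zero, ← hgu v hij, ← hA₁, ← Matrix.map_mul]
    rfl
  · rw [map_zero, ← hgk v hij, ← hA₂, ← Matrix.map_mul]
    rfl

/-! ### Bases adapted to chains of subspaces -/

section AdaptedBases

open Module

variable {K V : Type*} [Field K] [AddCommGroup V] [Module K V]

/-- The first `dim W` terms of the sequence `v` span `W`. -/
def Spans (v : ℕ → V) (W : Submodule K V) : Prop :=
  Submodule.span K (v '' Set.Iio (finrank K W)) = W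

lemma Spans.congr {v v' : ℕ → V} {W : Submodule K V} (h : Spans v W)
    (hv : ∀ i < finrank K W, v' i = v i) : Spans v' W := by
  unfold Spans
  rw [Set.image_congr (s := Set.Iio (finrank K W)) (g := v) fun i hi => hv i hi]
  exact h

variable [FiniteDimensional K V]

/-- Steinitz exchange: while `U ≠ W`, some vector of `C` lies outside `U`. Taking the new vectors in
`C` matters for submodularity, where `C` is the second subspace. -/
lemma Spans.extend {C : Submodule K V} {W : Submodule K V} :
    ∀ (m : ℕ) (U : Submodule K V) (v : ℕ → V), finrank K W - finrank K U = m → Spans v U →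
      U ⊔ C = W → ∃ v' : ℕ → V, (∀ i < finrank K U, v' i = v i) ∧
        (∀ i, finrank K U ≤ i → i < finrank K W → v' i ∈ C) ∧ Spans v' W
  | 0, U, v, hm, hv, hUC => by
    have hUW : U = W := Submodule.eq_of_le_of_finrank_le (hUC ▸ le_sup_left) (by omega)
    subst hUW
    exact ⟨v, fun _ _ => rfl, fun i h1 h2 => absurd h2 (not_lt.2 h1), hv⟩
  | m + 1, U, v, hm, hv, hUC => by
    have hCU : ¬ C ≤ U := fun h => by
      rw [sup_eq_left.2 h] at hUC
      subst hUC
      omega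
    obtain ⟨x, hxC, hxU⟩ := SetLike.not_le_iff_exists.1 hCU
    have hfin : finrank K ↥(U ⊔ Submodule.span K {x}) = finrank K U + 1 := by
      have hx : x ≠ 0 := fun h => hxU (h ▸ U.zero_mem)
      have h1 := Submodule.finrank_sup_add_finrank_inf_eq U (Submodule.span K {x})
      have h2 : U ⊓ Submodule.span K {x} = ⊥ :=
        (Submodule.disjoint_span_singleton_of_notMem hxU).eq_bot
      rw [h2, finrank_bot, finrank_span_singleton hx] at h1
      exact h1
    have hx : Submodule.span K {x} ≤ C := by simpa using hxC
    obtain ⟨v', h1, h2, h3⟩ := Spans.extend (C := C) (W := W) m (U ⊔ Submodule.span K {x})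
      (Function.update v (finrank K U) x) (by omega) (by
        unfold Spans
        have : (Set.Iio (finrank K ↥(U ⊔ Submodule.span K {x}))) =
            insert (finrank K U) (Set.Iio (finrank K U)) := by
          rw [hfin]; ext i; simp
        rw [this, Set.image_insert_eq, Submodule.span_insert, Function.update_self,
          sup_comm]
        congr 1
        exact hv.congr fun i hi => Function.update_of_ne hi.ne _ _) (by
        rw [sup_assoc, sup_eq_right.2 hx, hUC])
    rw [hfin] at h1 h2
    refine ⟨v', fun i hi => ?_, fun i hi hi' => ?_, h3⟩
    · rw [h1 i (by omega), Function.update_of_ne hi.ne]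
    · rcases hi.eq_or_lt with rfl | hi
      · rw [h1 _ (by omega), Function.update_self]
        exact hxC
      · exact h2 i hi hi'

lemma exists_spans_chain (U : ℕ → Submodule K V) (hU : Monotone U) (h0 : U 0 = ⊥) (r : ℕ) :
    ∃ v : ℕ → V, ∀ j ≤ r, Spans v (U j) := by
  induction r with
  | zero => exact ⟨0, fun j hj => by
      obtain rfl : j = 0 := by omega
      simp [Spans, h0]⟩
  | succ r ih =>
    obtain ⟨v, hv⟩ := ih
    obtain ⟨v', h1, -, h3⟩ := Spans.extend _ (U r) v rfl (hv r le_rfl)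
      (sup_eq_right.2 (hU r.le_succ))
    refine ⟨v', fun j hj => ?_⟩
    rcases hj.eq_or_lt with rfl | hj
    · exact h3
    · exact (hv j (by omega)).congr fun i hi =>
        h1 i (hi.trans_le (Submodule.finrank_mono (hU (by omega))))

end AdaptedBases

/-! ### Spans of rows -/

section RowSpan

open Module

variable {F : Type*} [Field F] {n : ℕ}

/-- The span of the rows of `δ` of index at least `c`. -/
def rowSpan (δ : GL (Fin n) F) (c : ℕ) : Submodule F (Fin n → F) :=
  Submodule.span F (Set.range fun i : {i : Fin n // c ≤ i} => (δ : Matrix (Fin n) (Fin n) F) i)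

lemma row_mem_rowSpan (δ : GL (Fin n) F) {c : ℕ} {i : Fin n} (hi : c ≤ i) :
    (δ : Matrix (Fin n) (Fin n) F) i ∈ rowSpan δ c :=
  Submodule.subset_span ⟨⟨i, hi⟩, rfl⟩

lemma rowSpan_antitone (δ : GL (Fin n) F) : Antitone (rowSpan δ) := fun _ _ h =>
  Submodule.span_mono (Set.range_subset_iff.2 fun i => ⟨⟨i, h.trans i.2⟩, rfl⟩)

lemma linearIndependent_row (δ : GL (Fin n) F) :
    LinearIndependent F fun i : Fin n => (δ : Matrix (Fin n) (Fin n) F) i :=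
  Matrix.linearIndependent_rows_iff_isUnit.2 δ.isUnit

lemma card_le_coe (c : ℕ) : Fintype.card {i : Fin n // c ≤ i} = n - c := by
  rw [Fintype.card_subtype]
  have : (Finset.univ.filter fun i : Fin n => c ≤ i).map Fin.valEmbedding = Finset.Ico c n := by
    ext j
    simp only [Finset.mem_map, Finset.mem_filter, Finset.mem_univ, true_and, Finset.mem_Ico]
    exact ⟨fun ⟨i, h, hi⟩ => hi ▸ ⟨h, i.2⟩, fun ⟨h, hj⟩ => ⟨⟨j, hj⟩, h, rfl⟩⟩
  rw [← Finset.card_map, this, Nat.card_Ico]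

lemma finrank_rowSpan (δ : GL (Fin n) F) (c : ℕ) : finrank F (rowSpan δ c) = n - c := by
  rw [← card_le_coe]
  exact finrank_span_eq_card ((linearIndependent_row δ).comp _ Subtype.val_injective)

lemma rowSpan_zero (δ : GL (Fin n) F) : rowSpan δ 0 = ⊤ :=
  Submodule.eq_top_of_finrank_eq (by rw [finrank_rowSpan]; simp)

lemma rowSpan_of_le (δ : GL (Fin n) F) {c : ℕ} (hc : n ≤ c) : rowSpan δ c = ⊥ := by
  rw [← Submodule.finrank_eq_zero (R := F), finrank_rowSpan]
  omega

/-- The entries of row `i` of `δ' * δ⁻¹` are the coordinates of row `i` of `δ'` in the basis of rows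
of `δ`. -/
lemma row_mem_rowSpan_iff (δ' δ : GL (Fin n) F) (c : ℕ) (i : Fin n) :
    (δ' : Matrix (Fin n) (Fin n) F) i ∈ rowSpan δ c ↔
      ∀ j : Fin n, (j : ℕ) < c → ((δ' * δ⁻¹ : GL (Fin n) F) : Matrix (Fin n) (Fin n) F) i j = 0 := by
  have hrow : (δ' : Matrix (Fin n) (Fin n) F) i =
      ∑ j, ((δ' * δ⁻¹ : GL (Fin n) F) : Matrix (Fin n) (Fin n) F) i j •
        (δ : Matrix (Fin n) (Fin n) F) j := by
    have : (δ' : Matrix (Fin n) (Fin n) F) =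
        ((δ' * δ⁻¹ : GL (Fin n) F) : Matrix (Fin n) (Fin n) F) * (δ : Matrix (Fin n) (Fin n) F) := by
      rw [← Units.val_mul, inv_mul_cancel_right]
    ext k
    conv_lhs => rw [this]
    simp [Matrix.mul_apply]
  constructor
  · intro h j hj
    have key : rowSpan δ c ≤ LinearMap.ker ((LinearMap.proj j).comp
        (Matrix.vecMulLinear ((δ⁻¹ : GL (Fin n) F) : Matrix (Fin n) (Fin n) F))) := by
      refine Submodule.span_le.2 (Set.range_subset_iff.2 fun k => ?_)
      have h0 : (δ : Matrix (Fin n) (Fin n) F) *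
          ((δ⁻¹ : GL (Fin n) F) : Matrix (Fin n) (Fin n) F) = 1 := by
        rw [← Units.val_mul, mul_inv_cancel, Units.val_one]
      have h1 := congrFun (congrFun h0 k.1) j
      rw [one_apply_ne (fun h => by have := k.2; omega)] at h1
      exact h1
    exact key h
  · intro h
    rw [hrow]
    refine Submodule.sum_mem _ fun j _ => ?_
    by_cases hj : c ≤ (j : ℕ)
    · exact Submodule.smul_mem _ _ (row_mem_rowSpan δ hj)
    · rw [h j (not_le.1 hj), zero_smul]
      exact Submodule.zero_mem _

lemma exists_GL_of_spans_top {v : ℕ → Fin n → F} (hv : Spans v (⊤ : Submodule F (Fin n → F))) :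
    ∃ δ : GL (Fin n) F, (∀ i : Fin n, (δ : Matrix (Fin n) (Fin n) F) i = v (n - 1 - i)) ∧
      ∀ c ≤ n, rowSpan δ c = Submodule.span F (v '' Set.Iio (n - c)) := by
  -- The order is reversed: spans of rows are taken from the bottom, spans of the sequence from its
  -- start.
  let M : Matrix (Fin n) (Fin n) F := fun i => v (n - 1 - i)
  have himage : ∀ c ≤ n, (Set.range fun i : {i : Fin n // c ≤ i} => M i) = v '' Set.Iio (n - c) := by
    intro c hc
    ext x
    simp only [Set.mem_range, Subtype.exists, exists_prop, Set.mem_image, Set.mem_Iio, M]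
    constructor
    · rintro ⟨i, hi, rfl⟩
      exact ⟨n - 1 - i, by omega, rfl⟩
    · rintro ⟨j, hj, rfl⟩
      exact ⟨⟨n - 1 - j, by omega⟩, by simp only; omega, by simp only; congr 1; omega⟩
  have hspan : Submodule.span F (Set.range M) = ⊤ := by
    have h1 := himage 0 (Nat.zero_le _)
    have h2 : Set.range M = Set.range fun i : {i : Fin n // 0 ≤ (i : ℕ)} => M i := by
      ext x; exact ⟨fun ⟨i, hi⟩ => ⟨⟨i, Nat.zero_le _⟩, hi⟩, fun ⟨i, hi⟩ => ⟨i.1, hi⟩⟩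
    rw [h2, h1]
    simpa [Spans] using hv
  have hM : IsUnit M := by
    rw [← Matrix.linearIndependent_rows_iff_isUnit]
    exact linearIndependent_of_top_le_span_of_card_eq_finrank hspan.ge (by simp)
  refine ⟨hM.unit, fun i => rfl, fun c hc => ?_⟩
  rw [← himage c hc]
  rfl

lemma exists_GL_chain (w : ℕ → Submodule F (Fin n → F)) (hw : Antitone w) (r : ℕ)
    (hr : w r = ⊥) :
    ∃ δ : GL (Fin n) F, ∀ j ≤ r, rowSpan δ (n - finrank F (w j)) = w j := by
  -- The chain is read upwards from `w r = ⊥`, and `⊤` is added at index `r + 1` to complete the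
  -- sequence to a basis.
  obtain ⟨v, hv⟩ := exists_spans_chain
    (fun j => if j ≤ r then w (r - j) else ⊤) (fun i j hij => by
      dsimp only
      split_ifs with h1 h2
      · exact hw (by omega)
      · exact le_top
      · omega
      · exact le_rfl) (by simp [hr]) (r + 1)
  obtain ⟨δ, -, hδ⟩ := exists_GL_of_spans_top (v := v) (by simpa using hv (r + 1) le_rfl)
  refine ⟨δ, fun j hj => ?_⟩
  have h1 := hv (r - j) (by omega)
  have h2 : r - (r - j) = j := by omega
  simp only [tsub_le_iff_right, le_add_iff_nonneg_right, zero_le, if_true, h2] at h1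
  rw [hδ _ (Nat.sub_le _ _)]
  have h3 : finrank F (w j) ≤ n := by simpa using Submodule.finrank_le (w j)
  rw [Nat.sub_sub_self h3]
  exact h1

lemma exists_rowSpan_eq (W : Submodule F (Fin n → F)) :
    ∃ δ : GL (Fin n) F, rowSpan δ (n - finrank F W) = W := by
  obtain ⟨δ, hδ⟩ := exists_GL_chain (fun j => if j = 0 then W else ⊥) (fun i j hij => by
    dsimp only
    split_ifs <;> first | omega | simp) 1 (by simp)
  exact ⟨δ, by simpa using hδ 0 (by omega)⟩

end RowSpan

/-! ### Heights of subspaces -/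

section Heights

open Module

variable {F : Type*} [Field F] [NumberField F] {n : ℕ}

/-- The determinant of the lower right block of `p`, of the rows and columns from `c` on. -/
def bottomDet {R : Type*} [CommRing R] (c : ℕ) (p : Matrix (Fin n) (Fin n) R) : R :=
  (p.submatrix (Subtype.val : {i : Fin n // c ≤ i} → Fin n) Subtype.val).det

/-- The span condition lets the factorization `p₀ = (δ₀ δ⁻¹) p (k k₀⁻¹)` restrict to a product of
square matrices: a rational one, the bottom block of `p`, and a minor of an element of `K`. The
first determinant has absolute value 1 by the product formula, the last at most 1. Arbitrary rows
`s` and columns `t` are allowed for the sake of submodularity. -/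
lemma adelicAbs_minor_le {g : GL (Fin n) (Adele F)} {δ₀ δ : GL (Fin n) F}
    {p₀ k₀ p k : GL (Fin n) (Adele F)} (h₀ : rat δ₀ * g = p₀ * k₀) (hk₀ : k₀ ∈ maxCompact F n)
    (h : rat δ * g = p * k) (hk : k ∈ maxCompact F n) {c : ℕ}
    (hp : ∀ i j : Fin n, c ≤ i → (j : ℕ) < c →
      (p : Matrix (Fin n) (Fin n) (Adele F)) i j = 0)
    {ι : Type*} [Fintype ι] [DecidableEq ι] (e : ι ≃ {i : Fin n // c ≤ i}) {s t : ι → Fin n}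
    (ht : t.Injective)
    (hspan : ∀ i, (δ₀ : Matrix (Fin n) (Fin n) F) (s i) ∈ rowSpan δ c)
    (hu : IsUnit ((p₀ : Matrix (Fin n) (Fin n) (Adele F)).submatrix s t).det) :
    adelicAbs ((p₀ : Matrix (Fin n) (Fin n) (Adele F)).submatrix s t).det ≤
      adelicAbs (bottomDet c (p : Matrix (Fin n) (Fin n) (Adele F))) := by
  let b : ι → Fin n := fun i => (e i).1
  have hb : b.Injective := Subtype.val_injective.comp e.injective
  let q : Matrix ι ι F :=
    ((δ₀ * δ⁻¹ : GL (Fin n) F) : Matrix (Fin n) (Fin n) F).submatrix s b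
  let κ : GL (Fin n) (Adele F) := k * k₀⁻¹
  have hκ : κ ∈ maxCompact F n := mul_mem hk (inv_mem hk₀)
  have hp₀ : p₀ = rat (δ₀ * δ⁻¹) * (p * κ) := by
    have : p₀ = rat δ₀ * g * k₀⁻¹ := by rw [h₀]; group
    rw [this, map_mul, map_inv]
    have : p * κ = rat δ * g * k₀⁻¹ := by rw [h]; simp only [κ]; group
    rw [this]; group
  have hsum : ∀ f : Fin n → Adele F, (∀ j : Fin n, (j : ℕ) < c → f j = 0) →
      ∑ j, f j = ∑ i : ι, f (b i) := fun f hf => by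
    rw [e.sum_comp (fun i => f i.1), ← Fintype.sum_subtype_add_sum_subtype (fun j : Fin n => c ≤ j) f,
      Finset.sum_eq_zero (s := (Finset.univ : Finset {j : Fin n // ¬ c ≤ j}))
        fun j _ => hf j.1 (not_le.1 j.2), add_zero]
  have hq : ∀ i, ∀ j : Fin n, (j : ℕ) < c →
      ((δ₀ * δ⁻¹ : GL (Fin n) F) : Matrix (Fin n) (Fin n) F) (s i) j = 0 :=
    fun i => (row_mem_rowSpan_iff δ₀ δ c (s i)).1 (hspan i)
  have hmul : (p₀ : Matrix (Fin n) (Fin n) (Adele F)).submatrix s t =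
      q.map (algebraMap F (Adele F)) * ((p : Matrix (Fin n) (Fin n) (Adele F)).submatrix b b *
        (κ : Matrix (Fin n) (Fin n) (Adele F)).submatrix b t) := by
    ext i j
    rw [hp₀, submatrix_apply, Units.val_mul, Matrix.mul_apply, hsum _ fun l hl => ?_,
      Matrix.mul_apply]
    · refine Finset.sum_congr rfl fun l _ => ?_
      congr 1
      rw [Units.val_mul, Matrix.mul_apply, hsum _ fun m hm => ?_, Matrix.mul_apply]
      · rfl
      · rw [hp _ _ (e l).2 hm, zero_mul]
    · have : (rat (δ₀ * δ⁻¹) : GL (Fin n) (Adele F)).1 (s i) l =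
        algebraMap F (Adele F) (((δ₀ * δ⁻¹ : GL (Fin n) F) : Matrix (Fin n) (Fin n) F) (s i) l) :=
          rfl
      rw [this, hq i l hl, map_zero, zero_mul]
  have hbot : ((p : Matrix (Fin n) (Fin n) (Adele F)).submatrix b b).det =
      bottomDet c (p : Matrix (Fin n) (Fin n) (Adele F)) :=
    det_submatrix_equiv_self e ((p : Matrix (Fin n) (Fin n) (Adele F)).submatrix
      (Subtype.val : {i : Fin n // c ≤ i} → Fin n) Subtype.val)
  have hqd : (q.map (algebraMap F (Adele F))).det = algebraMap F (Adele F) q.det :=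
    ((algebraMap F (Adele F)).map_det q).symm
  rw [hmul, det_mul, det_mul] at hu ⊢
  have hu₁ := isUnit_of_mul_isUnit_left hu
  have hu₂ := isUnit_of_mul_isUnit_right hu
  have hu₃ := isUnit_of_mul_isUnit_left hu₂
  have hu₄ := isUnit_of_mul_isUnit_right hu₂
  rw [adelicAbs_mul hu₁ hu₂, adelicAbs_mul hu₃ hu₄, hqd, adelicAbs_algebraMap, one_mul, ← hbot]
  · exact mul_le_of_le_one_right (adelicAbs_nonneg _) (adelicAbs_det_submatrix_le_one hκ hb ht)
  -- The rational determinant is nonzero because it divides a unit minor.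
  · rintro h0
    rw [hqd, h0, map_zero] at hu₁
    have : Nontrivial (Adele F) := (AdeleRing.algebraMap_injective (𝓞 F) F).nontrivial
    exact not_isUnit_zero hu₁

/-- `(δ, c, p)` computes the height of the subspace `W` relative to `g`: the last rows of `δ` from
`c` on span `W`, and `p` is the parabolic part of an Iwasawa decomposition of `δ g`. -/
structure Computes (g : GL (Fin n) (Adele F)) (W : Submodule F (Fin n → F)) (c : ℕ)
    (p : GL (Fin n) (Adele F)) : Prop where
  le : c ≤ n
  exists_eq : ∃ δ : GL (Fin n) F, rowSpan δ c = W ∧ ∃ k ∈ maxCompact F n, rat δ * g = p * k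
  eq_zero : ∀ i j : Fin n, c ≤ i → (j : ℕ) < c → (p : Matrix (Fin n) (Fin n) (Adele F)) i j = 0

lemma Computes.eq_sub_finrank {g : GL (Fin n) (Adele F)} {W : Submodule F (Fin n → F)} {c : ℕ}
    {p : GL (Fin n) (Adele F)} (h : Computes g W c p) : c = n - finrank F W := by
  obtain ⟨δ, rfl, -⟩ := h.exists_eq
  rw [finrank_rowSpan]
  have := h.le
  omega

lemma isUnit_bottomDet {p : GL (Fin n) (Adele F)} {c : ℕ}
    (hp : ∀ i j : Fin n, c ≤ i → (j : ℕ) < c →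
      (p : Matrix (Fin n) (Fin n) (Adele F)) i j = 0) :
    IsUnit (bottomDet c (p : Matrix (Fin n) (Fin n) (Adele F))) := by
  have h := (isUnit_iff_isUnit_det _).1 p.isUnit
  rw [twoBlockTriangular_det' _ (fun i : Fin n => c ≤ i)
    (fun i hi j hj => hp i j hi (not_le.1 hj))] at h
  exact isUnit_of_mul_isUnit_left h

/-- By symmetry this is an equality, which makes `logHeight` independent of the choices in its
definition. -/
lemma Computes.adelicAbs_le {g : GL (Fin n) (Adele F)} {W : Submodule F (Fin n → F)} {c c' : ℕ}
    {p p' : GL (Fin n) (Adele F)} (h : Computes g W c p) (h' : Computes g W c' p') :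
    adelicAbs (bottomDet c (p : Matrix (Fin n) (Fin n) (Adele F))) ≤
      adelicAbs (bottomDet c' (p' : Matrix (Fin n) (Fin n) (Adele F))) := by
  obtain rfl : c' = c := h'.eq_sub_finrank.trans h.eq_sub_finrank.symm
  obtain ⟨δ, hδ, k, hk, hpk⟩ := h.exists_eq
  obtain ⟨δ', hδ', k', hk', hpk'⟩ := h'.exists_eq
  exact adelicAbs_minor_le hpk hk hpk' hk' h'.eq_zero (Equiv.refl _) Subtype.val_injective
    (fun i => by rw [hδ', ← hδ]; exact row_mem_rowSpan δ i.2) (isUnit_bottomDet h.eq_zero)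

open Classical in
/-- The logarithmic height of the subspace `W` relative to `g`: the logarithm of the covolume of
`W g`. -/
def logHeight (g : GL (Fin n) (Adele F)) (W : Submodule F (Fin n → F)) : ℝ :=
  if h : ∃ x : ℕ × GL (Fin n) (Adele F), Computes g W x.1 x.2 then
    Real.log (adelicAbs (bottomDet h.choose.1
      (h.choose.2 : Matrix (Fin n) (Fin n) (Adele F)))) else 0

lemma Computes.logHeight_eq {g : GL (Fin n) (Adele F)} {W : Submodule F (Fin n → F)} {c : ℕ}
    {p : GL (Fin n) (Adele F)} (h : Computes g W c p) :
    logHeight g W =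
      Real.log (adelicAbs (bottomDet c (p : Matrix (Fin n) (Fin n) (Adele F)))) := by
  have hex : ∃ x : ℕ × GL (Fin n) (Adele F), Computes g W x.1 x.2 := ⟨(c, p), h⟩
  rw [logHeight, dif_pos hex]
  exact congrArg Real.log (le_antisymm (hex.choose_spec.adelicAbs_le h)
    (h.adelicAbs_le hex.choose_spec))

lemma isUnit_diag {p : GL (Fin n) (Adele F)}
    (hp : (p : Matrix (Fin n) (Fin n) (Adele F)).BlockTriangular id) (i : Fin n) :
    IsUnit ((p : Matrix (Fin n) (Fin n) (Adele F)) i i) := by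
  have h := (isUnit_iff_isUnit_det _).1 p.isUnit
  rw [det_of_isUpperTriangular hp] at h
  exact isUnit_of_dvd_unit (Finset.dvd_prod_of_mem
    (fun i => (p : Matrix (Fin n) (Fin n) (Adele F)) i i) (Finset.mem_univ i)) h

lemma adelicAbs_prod {ι : Type*} (s : Finset ι) (x : ι → Adele F) (hx : ∀ i ∈ s, IsUnit (x i)) :
    Real.log (adelicAbs (∏ i ∈ s, x i)) = ∑ i ∈ s, Real.log (adelicAbs (x i)) := by
  classical
  induction s using Finset.induction_on with
  | empty => simp [adelicAbs_one]
  | insert a s ha ih =>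
    have h1 : IsUnit (x a) := hx a (Finset.mem_insert_self _ _)
    have h2 : ∀ i ∈ s, IsUnit (x i) := fun i hi => hx i (Finset.mem_insert_of_mem hi)
    have h3 : IsUnit (∏ i ∈ s, x i) := by
      rw [IsUnit.prod_iff]
      exact h2
    rw [Finset.prod_insert ha, Finset.sum_insert ha, adelicAbs_mul h1 h3,
      Real.log_mul (adelicAbs_pos h1).ne' (adelicAbs_pos h3).ne', ih h2]

lemma det_submatrix_val {R : Type*} [CommRing R] {p : Matrix (Fin n) (Fin n) R}
    (hp : p.BlockTriangular id) (S : Finset (Fin n)) :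
    (p.submatrix (Subtype.val : S → Fin n) Subtype.val).det = ∏ i ∈ S, p i i := by
  rw [det_of_isUpperTriangular (fun i j hij => hp (i := i.1) (j := j.1) hij)]
  exact Finset.prod_coe_sort S fun i => p i i

end Heights

/-! ### Submodularity of the height -/

section Submodularity

open Module

variable {F : Type*} [Field F] [NumberField F] {n : ℕ}

lemma computes_of_isUpperTriangular {g : GL (Fin n) (Adele F)} {δ : GL (Fin n) F}
    {p k : GL (Fin n) (Adele F)}
    (hp : (p : Matrix (Fin n) (Fin n) (Adele F)).BlockTriangular id) (hk : k ∈ maxCompact F n)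
    (h : rat δ * g = p * k) {c : ℕ} (hc : c ≤ n) : Computes g (rowSpan δ c) c p :=
  ⟨hc, ⟨δ, rfl, k, hk, h⟩, fun i j hi hj => hp (show j < i from Fin.lt_def.2 (by omega))⟩

lemma logHeight_rowSpan_of_isUpperTriangular {g : GL (Fin n) (Adele F)} {δ : GL (Fin n) F}
    {p k : GL (Fin n) (Adele F)}
    (hp : (p : Matrix (Fin n) (Fin n) (Adele F)).BlockTriangular id) (hk : k ∈ maxCompact F n)
    (h : rat δ * g = p * k) {c : ℕ} (hc : c ≤ n) :
    logHeight g (rowSpan δ c) = ∑ i ∈ Finset.univ.filter fun i : Fin n => c ≤ i,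
      Real.log (adelicAbs ((p : Matrix (Fin n) (Fin n) (Adele F)) i i)) := by
  rw [(computes_of_isUpperTriangular hp hk h hc).logHeight_eq, bottomDet,
    det_of_isUpperTriangular (fun i j hij => hp (i := i.1) (j := j.1) hij),
    ← adelicAbs_prod _ _ fun i _ => isUnit_diag hp i]
  congr 2
  exact (Finset.prod_subtype (Finset.univ.filter fun i : Fin n => c ≤ i)
    (p := fun i : Fin n => c ≤ i) (by simp)
    fun i => (p : Matrix (Fin n) (Fin n) (Adele F)) i i).symm

/-- The logarithmic height is submodular. -/
theorem logHeight_sup_add_inf_le (g : GL (Fin n) (Adele F)) (W₁ W₂ : Submodule F (Fin n → F)) :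
    logHeight g (W₁ ⊔ W₂) + logHeight g (W₁ ⊓ W₂) ≤ logHeight g W₁ + logHeight g W₂ := by
  -- A basis adapted to `W₁ ⊓ W₂ ≤ W₁ ≤ W₁ ⊔ W₂ ≤ ⊤`, whose third batch of vectors is taken in `W₂`.
  obtain ⟨v₁, hv₁⟩ := exists_spans_chain
    (fun j => if j = 0 then ⊥ else if j = 1 then W₁ ⊓ W₂ else W₁) (fun i j hij => by
      dsimp only
      split_ifs <;> first | omega | simp) (by simp) 2
  obtain ⟨v₂, h₂, h₂', hs₂⟩ := Spans.extend (C := W₂) _ W₁ v₁ rfl (by simpa using hv₁ 2 le_rfl) rfl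
  obtain ⟨v₃, h₃, -, hs₃⟩ := Spans.extend (C := ⊤) _ (W₁ ⊔ W₂) v₂ rfl hs₂ (sup_top_eq _)
  have hdim := Submodule.finrank_sup_add_finrank_inf_eq W₁ W₂
  have hab := Submodule.finrank_mono (inf_le_left : W₁ ⊓ W₂ ≤ W₁)
  have hbd := Submodule.finrank_mono (le_sup_left : W₁ ≤ W₁ ⊔ W₂)
  have hdn : finrank F ↥(W₁ ⊔ W₂) ≤ n := by simpa using Submodule.finrank_le (W₁ ⊔ W₂)
  have hen : finrank F W₂ ≤ n := by simpa using Submodule.finrank_le W₂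
  have hD : Spans v₃ (W₁ ⊔ W₂) := hs₂.congr h₃
  have hB : Spans v₃ W₁ := (show Spans v₁ W₁ by simpa using hv₁ 2 le_rfl).congr fun i hi => by
    rw [h₃ i (by omega), h₂ i hi]
  have hA : Spans v₃ (W₁ ⊓ W₂) :=
    (show Spans v₁ (W₁ ⊓ W₂) by simpa using hv₁ 1 (by omega)).congr fun i hi => by
      rw [h₃ i (by omega), h₂ i (by omega)]
  obtain ⟨δ, hδ, hδ'⟩ := exists_GL_of_spans_top hs₃
  have hrow : ∀ W : Submodule F (Fin n → F), Spans v₃ W → rowSpan δ (n - finrank F W) = W := by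
    intro W hW
    have hWn : finrank F W ≤ n := by simpa using Submodule.finrank_le W
    rw [hδ' _ (Nat.sub_le _ _), Nat.sub_sub_self hWn]
    exact hW
  obtain ⟨p, hp, k, hk, hpk⟩ := exists_isUpperTriangular_mul_maxCompact (rat δ * g)
  have hheight : ∀ W : Submodule F (Fin n → F), Spans v₃ W → logHeight g W =
      ∑ i ∈ Finset.univ.filter fun i : Fin n => n - finrank F W ≤ i,
        Real.log (adelicAbs ((p : Matrix (Fin n) (Fin n) (Adele F)) i i)) := by
    intro W hW
    rw [← logHeight_rowSpan_of_isUpperTriangular hp hk hpk (Nat.sub_le _ _), hrow W hW]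
  let T : ℕ → Finset (Fin n) := fun c => Finset.univ.filter fun i : Fin n => c ≤ i
  -- The rows indexed by `S` span the intersection and the batch taken in `W₂`: as many rows of `W₂`
  -- as its dimension, though not a final segment of rows.
  let S : Finset (Fin n) := T (n - finrank F ↥(W₁ ⊓ W₂)) ∪
    (T (n - finrank F ↥(W₁ ⊔ W₂)) \ T (n - finrank F W₁))
  have hTmono : ∀ {c c' : ℕ}, c ≤ c' → T c' ⊆ T c := fun hc i hi => by
    simp only [T, Finset.mem_filter, Finset.mem_univ, true_and] at hi ⊢
    omega
  have hsum : ∀ f : Fin n → ℝ, ∑ i ∈ S, f i + ∑ i ∈ T (n - finrank F W₁), f i =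
      ∑ i ∈ T (n - finrank F ↥(W₁ ⊓ W₂)), f i + ∑ i ∈ T (n - finrank F ↥(W₁ ⊔ W₂)), f i := by
    intro f
    have hdisj : Disjoint (T (n - finrank F ↥(W₁ ⊓ W₂)))
        (T (n - finrank F ↥(W₁ ⊔ W₂)) \ T (n - finrank F W₁)) :=
      Finset.disjoint_sdiff.mono_left (hTmono (by omega))
    rw [Finset.sum_union hdisj, add_assoc, Finset.sum_sdiff (hTmono (by omega))]
  have hTcard : ∀ c, (T c).card = n - c := fun c => by
    rw [← card_le_coe c, Fintype.card_subtype]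
  have hScard : Fintype.card S = Fintype.card {i : Fin n // n - finrank F W₂ ≤ i} := by
    have h1 := hsum fun _ => 1
    simp only [Finset.sum_const, nsmul_eq_mul, mul_one, hTcard] at h1
    rw [Fintype.card_coe, card_le_coe]
    have h2 : S.card + (n - (n - finrank F W₁)) =
      (n - (n - finrank F ↥(W₁ ⊓ W₂))) + (n - (n - finrank F ↥(W₁ ⊔ W₂))) := by exact_mod_cast h1
    omega
  have hSmem : ∀ i : S, (δ : Matrix (Fin n) (Fin n) F) i.1 ∈ W₂ := by
    rintro ⟨i, hi⟩
    simp only [S, T, Finset.mem_union, Finset.mem_sdiff, Finset.mem_filter, Finset.mem_univ,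
      true_and, not_le] at hi
    have := i.2
    dsimp only
    rcases hi with hi | hi
    · have : (δ : Matrix (Fin n) (Fin n) F) i ∈ W₁ ⊓ W₂ := by
        rw [← hrow _ hA]
        exact row_mem_rowSpan δ hi
      exact this.2
    · rw [hδ, h₃ _ (by omega)]
      exact h₂' _ (by omega) (by omega)
  obtain ⟨δ', hδ₂⟩ := exists_rowSpan_eq W₂
  obtain ⟨p', hp', k', hk', hpk'⟩ := exists_isUpperTriangular_mul_maxCompact (rat δ' * g)
  have hcomp := computes_of_isUpperTriangular hp' hk' hpk' (Nat.sub_le n (finrank F W₂))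
  have hunit : IsUnit (∏ i ∈ S, (p : Matrix (Fin n) (Fin n) (Adele F)) i i) := by
    rw [IsUnit.prod_iff]
    exact fun i _ => isUnit_diag hp i
  -- The diagonal minor of `p` on `S` is at most the covolume of `W₂`. As `p` is triangular, its
  -- logarithm is the sum over `S`, namely `h(W₁ ⊓ W₂) + h(W₁ ⊔ W₂) - h(W₁)` with `h` the height.
  have hmin := adelicAbs_minor_le hpk hk hpk' hk' hcomp.eq_zero
    (Fintype.equivOfCardEq hScard) (s := (Subtype.val : S → Fin n))
    (t := (Subtype.val : S → Fin n)) Subtype.val_injective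
    (fun i => by rw [hδ₂]; exact hSmem i) (by rw [det_submatrix_val hp]; exact hunit)
  rw [det_submatrix_val hp] at hmin
  have hlog := Real.log_le_log (adelicAbs_pos hunit) hmin
  rw [← hcomp.logHeight_eq, hδ₂, adelicAbs_prod _ _ fun i _ => isUnit_diag hp i] at hlog
  rw [hheight _ hA, hheight _ hB, hheight _ hD]
  have := hsum fun i => Real.log (adelicAbs ((p : Matrix (Fin n) (Fin n) (Adele F)) i i))
  simp only [T] at this
  linarith

end Submodularity

/-! ### The Harish-Chandra map in terms of heights -/

section HarishChandra

variable {n : ℕ}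

/-- Valid also for `k` beyond `P.length`, where `sizeUpTo` stays at `n` and both sides fail. -/
lemma sizeUpTo_le_iff (P : Composition n) {k : ℕ} {i : Fin n} :
    P.sizeUpTo k ≤ i ↔ k ≤ P.index i := by
  constructor
  · intro h
    by_contra hk
    have h1 := P.monotone_sizeUpTo (show (P.index i : ℕ) + 1 ≤ k by omega)
    have h2 := P.lt_sizeUpTo_index_succ i
    rw [Fin.val_succ] at h2
    omega
  · intro h
    exact (P.monotone_sizeUpTo h).trans (P.sizeUpTo_index_le i)

lemma index_monotone (P : Composition n) : Monotone P.index := fun i _ hij =>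
  (sizeUpTo_le_iff P).1 ((P.sizeUpTo_index_le i).trans hij)

lemma sizeUpTo_succ_eq (P : Composition n) (k : Fin P.length) :
    P.sizeUpTo (k + 1) = P.sizeUpTo k + P.blocksFun k := P.sizeUpTo_succ' k

variable {F : Type*} [Field F] [NumberField F]

/-- The height of the quotient of the whole space by `W`. -/
def quotHeight (g : GL (Fin n) (Adele F)) (W : Submodule F (Fin n → F)) : ℝ :=
  logHeight g ⊤ - logHeight g W

lemma bottomDet_sizeUpTo {P : Composition n} {p : GL (Fin n) (Adele F)}
    (hp : p ∈ parabolic P (Adele F)) (k : ℕ) :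
    bottomDet (P.sizeUpTo k) (p : Matrix (Fin n) (Fin n) (Adele F)) =
      ∏ a ∈ Finset.univ.filter fun a : Fin P.length => k ≤ a,
        ((p : Matrix (Fin n) (Fin n) (Adele F)).toSquareBlock P.index a).det := by
  rw [bottomDet, BlockTriangular.det_fintype (BlockTriangular.submatrix hp), Finset.prod_filter]
  refine Finset.prod_congr rfl fun a _ => ?_
  split_ifs with h
  · let e : {i : Fin n // P.index i = a} ≃
        {i : {i : Fin n // P.sizeUpTo k ≤ i} // (P.index ∘ Subtype.val) i = a} :=
      { toFun := fun i => ⟨⟨i.1, (sizeUpTo_le_iff P).2 (by rw [i.2]; exact h)⟩, i.2⟩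
        invFun := fun i => ⟨i.1.1, i.2⟩
        left_inv := fun _ => rfl
        right_inv := fun _ => rfl }
    exact (det_submatrix_equiv_self e _).symm
  · have : IsEmpty {i : {i : Fin n // P.sizeUpTo k ≤ i} // (P.index ∘ Subtype.val) i = a} :=
      ⟨fun i => h (by rw [← i.2]; exact (sizeUpTo_le_iff P).1 i.1.2)⟩
    exact det_isEmpty

lemma isUnit_det_toSquareBlock {P : Composition n} {p : GL (Fin n) (Adele F)}
    (hp : p ∈ parabolic P (Adele F)) (a : Fin P.length) :
    IsUnit ((p : Matrix (Fin n) (Fin n) (Adele F)).toSquareBlock P.index a).det := by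
  have h := (isUnit_iff_isUnit_det _).1 p.isUnit
  rw [BlockTriangular.det_fintype hp] at h
  exact isUnit_of_dvd_unit (Finset.dvd_prod_of_mem (fun a =>
    ((p : Matrix (Fin n) (Fin n) (Adele F)).toSquareBlock P.index a).det) (Finset.mem_univ a)) h

lemma logHeight_rowSpan_sizeUpTo {P : Composition n} {g : GL (Fin n) (Adele F)}
    {δ : GL (Fin n) F} {p k : GL (Fin n) (Adele F)} (hp : p ∈ parabolic P (Adele F))
    (hk : k ∈ maxCompact F n) (h : rat δ * g = p * k) (j : ℕ) :
    logHeight g (rowSpan δ (P.sizeUpTo j)) = ∑ a ∈ Finset.univ.filter fun a : Fin P.length => j ≤ a,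
      Real.log (adelicAbs
        ((p : Matrix (Fin n) (Fin n) (Adele F)).toSquareBlock P.index a).det) := by
  have hc : Computes g (rowSpan δ (P.sizeUpTo j)) (P.sizeUpTo j) p :=
    ⟨P.sizeUpTo_le j, ⟨δ, rfl, k, hk, h⟩, fun i l hi hl => hp (by
      have h1 := (sizeUpTo_le_iff P).1 hi
      have h2 := (sizeUpTo_le_iff P (k := j) (i := l)).not.1 (not_le.2 hl)
      exact Fin.lt_def.2 (by omega))⟩
  rw [hc.logHeight_eq, bottomDet_sizeUpTo hp,
    adelicAbs_prod _ _ fun a _ => isUnit_det_toSquareBlock hp a]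

/-- The logarithm of a block determinant is a difference of consecutive heights, so the chosen
Iwasawa decomposition drops out. -/
lemma harishChandra_apply (P : Composition n) (δ : GL (Fin n) F) (g : GL (Fin n) (Adele F))
    (i : Fin n) : harishChandra P (rat δ * g) i =
      (quotHeight g (rowSpan δ (P.sizeUpTo (P.index i + 1))) -
        quotHeight g (rowSpan δ (P.sizeUpTo (P.index i)))) / P.blocksFun (P.index i) := by
  have hex : ∃ p ∈ parabolic P (Adele F), ∃ k ∈ maxCompact F n, rat δ * g = p * k := by
    obtain ⟨p, hp, k, hk, h⟩ := exists_isUpperTriangular_mul_maxCompact (rat δ * g)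
    refine ⟨p, fun i j hij => hp (show j < i from ?_), k, hk, h⟩
    exact lt_of_not_ge fun hle => absurd (index_monotone P hle) (not_le.2 hij)
  rw [harishChandra, dif_pos hex]
  obtain ⟨hp, k, hk, h⟩ := hex.choose_spec
  have hj := logHeight_rowSpan_sizeUpTo hp hk h
  have hsplit : (Finset.univ.filter fun a : Fin P.length => (P.index i : ℕ) ≤ a) =
      insert (P.index i) (Finset.univ.filter fun a : Fin P.length => (P.index i : ℕ) + 1 ≤ a) := by
    ext a
    simp only [Finset.mem_filter, Finset.mem_univ, true_and, Finset.mem_insert, Fin.ext_iff]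
    omega
  rw [parabolicLog, quotHeight, quotHeight, hj, hj, hsplit, Finset.sum_insert (by simp)]
  congr 1
  ring

lemma quotHeight_top (g : GL (Fin n) (Adele F)) : quotHeight g ⊤ = 0 := sub_self _

lemma quotHeight_add_le (g : GL (Fin n) (Adele F)) (U W : Submodule F (Fin n → F)) :
    quotHeight g U + quotHeight g W ≤ quotHeight g (U ⊓ W) + quotHeight g (U ⊔ W) := by
  have := logHeight_sup_add_inf_le g U W
  unfold quotHeight
  linarith

/-- Every `W` has a complement among the finitely many coordinate subspaces `C S`, and
supermodularity then gives `f W ≤ f ⊥ - f (C S)`. -/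
lemma quotHeight_bddAbove (g : GL (Fin n) (Adele F)) :
    BddAbove (Set.range (quotHeight g)) := by
  classical
  let C : Finset (Fin n) → Submodule F (Fin n → F) := fun S =>
    Submodule.span F ((fun i => Pi.single i (1 : F)) '' (S : Set (Fin n)))
  obtain ⟨B, hB⟩ := (Set.finite_range fun S => quotHeight g ⊥ - quotHeight g (C S)).bddAbove
  refine ⟨B, Set.forall_mem_range.2 fun W => ?_⟩
  -- A maximal `S` with `W ⊓ C S = ⊥` gives a complement: a coordinate vector outside `W ⊔ C S`
  -- could be added to it.
  obtain ⟨S, hS⟩ := Finset.exists_maximal (s := Finset.univ.filter fun S => W ⊓ C S = ⊥)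
    ⟨∅, by simp [C]⟩
  have hS₁ : W ⊓ C S = ⊥ := by simpa using hS.1
  have hS₂ : W ⊔ C S = ⊤ := by
    have hi : ∀ i : Fin n, (Pi.single i (1 : F) : Fin n → F) ∈ W ⊔ C S := by
      intro i
      by_contra hi
      have hins : C (insert i S) = C S ⊔ Submodule.span F {Pi.single i (1 : F)} := by
        simp only [C, Finset.coe_insert, Set.image_insert_eq, Submodule.span_insert, sup_comm]
      have h1 : W ⊓ C (insert i S) = ⊥ := by
        have hd : Disjoint W (C S) := disjoint_iff.2 hS₁
        have hd' : Disjoint (W ⊔ C S) (Submodule.span F {Pi.single i (1 : F)}) :=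
          Submodule.disjoint_span_singleton_of_notMem hi
        rw [hins]
        exact (hd.disjoint_sup_right_of_disjoint_sup_left hd').eq_bot
      have h2 := hS.2 (y := insert i S) (by simpa using h1) (Finset.subset_insert i S)
      have h3 : i ∈ S := h2 (Finset.mem_insert_self i S)
      exact hi (Submodule.mem_sup_right (Submodule.subset_span ⟨i, h3, rfl⟩))
    rw [eq_top_iff, ← (Pi.basisFun F (Fin n)).span_eq, Submodule.span_le]
    rintro _ ⟨i, rfl⟩
    rw [Pi.basisFun_apply]
    exact hi i
  have h := quotHeight_add_le g W (C S)
  rw [hS₁, hS₂, quotHeight_top] at h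
  have := hB ⟨S, rfl⟩
  dsimp only at this
  linarith

end HarishChandra

/-! ### Harder–Narasimhan chains of supermodular functions -/

section HarderNarasimhan

open Module

variable {K V : Type*} [Field K] [AddCommGroup V] [Module K V]

/-- A Harder–Narasimhan chain `W = w 0 > ⋯ > w r = 0` for `f`, with slopes `μ 0 > ⋯ > μ (r - 1)`. -/
structure HNChain (f : Submodule K V → ℝ) (W : Submodule K V) (r : ℕ) (w : ℕ → Submodule K V)
    (μ : ℕ → ℝ) : Prop where
  zero : w 0 = W
  last : w r = ⊥
  anti : Antitone w
  strict : ∀ k < r, w (k + 1) < w k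
  slope : ∀ k < r, f (w (k + 1)) - f (w k) = μ k * (finrank K (w k) - finrank K (w (k + 1)))
  semistable : ∀ k < r, ∀ U, w (k + 1) ≤ U → U ≤ w k →
    f U - f (w k) ≤ μ k * (finrank K (w k) - finrank K U)
  decreasing : ∀ k, k + 1 < r → μ (k + 1) < μ k

variable [FiniteDimensional K V] {f : Submodule K V → ℝ}

/-- There may be infinitely many subspaces, so attaining the supremum needs an argument. The last
clause, that no smaller subspace reaches the slope, will make the slopes of the chain strictly
decrease. -/
lemma exists_maximal_slope (hf : ∀ U W, f U + f W ≤ f (U ⊓ W) + f (U ⊔ W))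
    (hb : BddAbove (Set.range f)) {W : Submodule K V} (hW : W ≠ ⊥) :
    ∃ W' < W, ∃ μ : ℝ, f W' - f W = μ * (finrank K W - finrank K W') ∧
      (∀ U ≤ W, f U - f W ≤ μ * (finrank K W - finrank K U)) ∧
      ∀ U < W, finrank K U < finrank K W' → f U - f W < μ * (finrank K W - finrank K U) := by
  obtain ⟨B, hB⟩ := hb
  have hpos : ∀ U < W, (1 : ℝ) ≤ finrank K W - finrank K U := fun U hU => by
    have h1 : (finrank K U : ℝ) + 1 ≤ finrank K W := by
      exact_mod_cast Submodule.finrank_lt_finrank_of_lt hU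
    linarith
  let s : Submodule K V → ℝ := fun U => (f U - f W) / (finrank K W - finrank K U)
  have hbdd : BddAbove (s '' Set.Iio W) := by
    refine ⟨|B - f W|, ?_⟩
    rintro _ ⟨U, hU, rfl⟩
    have h1 := hpos U hU
    have h2 : f U ≤ B := hB ⟨U, rfl⟩
    have h3 := le_abs_self (B - f W)
    have h4 := abs_nonneg (B - f W)
    simp only [s]
    rw [div_le_iff₀ (by linarith)]
    nlinarith
  have hne : (s '' Set.Iio W).Nonempty := ⟨_, ⊥, bot_lt_iff_ne_bot.2 hW, rfl⟩
  let μ : ℝ := sSup (s '' Set.Iio W)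
  -- The defect below the line of maximal slope: nonnegative under `W`, submodular, and with infimum
  -- 0 over proper subspaces.
  let φ : Submodule K V → ℝ := fun U => μ * (finrank K W - finrank K U) - (f U - f W)
  have hφ0 : ∀ U ≤ W, 0 ≤ φ U := by
    intro U hU
    rcases hU.eq_or_lt with rfl | hU
    · simp [φ]
    · have h1 := hpos U hU
      have h2 : s U ≤ μ := le_csSup hbdd ⟨U, hU, rfl⟩
      simp only [s] at h2
      rw [div_le_iff₀ (by linarith)] at h2
      simp only [φ]
      linarith
  have hφs : ∀ ε > 0, ∃ U < W, φ U < ε := by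
    intro ε hε
    have hdW : (0 : ℝ) < finrank K W := by
      have := hpos ⊥ (bot_lt_iff_ne_bot.2 hW)
      rw [finrank_bot] at this
      push_cast at this
      linarith
    obtain ⟨_, ⟨U, hU, rfl⟩, h⟩ := exists_lt_of_lt_csSup hne
      (show μ - ε / finrank K W < sSup (s '' Set.Iio W) from sub_lt_self _ (div_pos hε hdW))
    refine ⟨U, hU, ?_⟩
    have h1 := hpos U hU
    have h2 : (0 : ℝ) ≤ finrank K U := Nat.cast_nonneg _
    have h3 : s U * (finrank K W - finrank K U) = f U - f W :=
      div_mul_cancel₀ _ (by linarith)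
    have h4 : ε / finrank K W * finrank K W = ε := div_mul_cancel₀ _ hdW.ne'
    have h5 : 0 < ε / finrank K W := div_pos hε hdW
    simp only [φ]
    nlinarith
  have hφmod : ∀ U U', φ (U ⊓ U') + φ (U ⊔ U') ≤ φ U + φ U' := by
    intro U U'
    have h1 := hf U U'
    have h2 : (finrank K ↥(U ⊔ U') : ℝ) + finrank K ↥(U ⊓ U') = finrank K U + finrank K U' := by
      exact_mod_cast Submodule.finrank_sup_add_finrank_inf_eq U U'
    have h3 : (finrank K ↥(U ⊔ U') : ℝ) = finrank K U + finrank K U' - finrank K ↥(U ⊓ U') := by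
      linarith
    simp only [φ, h3]
    linarith
  have hex : ∃ m : ℕ, ∀ ε > 0, ∃ U < W, finrank K U ≤ m ∧ φ U < ε := ⟨finrank K W, fun ε hε => by
    obtain ⟨U, hU, h⟩ := hφs ε hε
    exact ⟨U, hU, Submodule.finrank_mono hU.le, h⟩⟩
  classical
  -- `m` is the least dimension bound under which the defect still gets arbitrarily small; in
  -- dimensions below `m` it is at least `ε₀`.
  obtain ⟨m, hm, hmin⟩ : ∃ m : ℕ, (∀ ε > 0, ∃ U < W, finrank K U ≤ m ∧ φ U < ε) ∧
      ∃ ε₀ > 0, ∀ U < W, finrank K U < m → ε₀ ≤ φ U := by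
    refine ⟨Nat.find hex, Nat.find_spec hex, ?_⟩
    rcases Nat.eq_zero_or_pos (Nat.find hex) with h0 | h0
    · exact ⟨1, one_pos, fun U _ h => by omega⟩
    · have h := Nat.find_min hex (Nat.sub_lt h0 one_pos)
      push Not at h
      obtain ⟨ε, hε, h⟩ := h
      exact ⟨ε, hε, fun U hU hlt => h U hU (by omega)⟩
  obtain ⟨ε₀, hε₀, hmin⟩ := hmin
  obtain ⟨U₀, hU₀, hd₀, hφ₀⟩ := hm (ε₀ / 2) (half_pos hε₀)
  have hdim : ∀ U < W, finrank K U ≤ m → φ U < ε₀ / 2 → finrank K U = m := fun U hU h h' => by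
    by_contra hne
    have := hmin U hU (by omega)
    linarith
  have hU₀φ : φ U₀ = 0 := by
    by_contra hne
    have hpos₀ : 0 < φ U₀ := lt_of_le_of_ne (hφ0 U₀ hU₀.le) (Ne.symm hne)
    -- If the defect of `U₀` were positive, another `U₁` of dimension `m` would do better. Both
    -- defects being below `ε₀ / 2`, their intersection, of dimension less than `m`, would have
    -- defect below `ε₀`.
    obtain ⟨U₁, hU₁, hd₁, hφ₁⟩ := hm (min (φ U₀) (ε₀ / 2)) (lt_min hpos₀ (half_pos hε₀))
    have hφ₁' := hφ₁.trans_le (min_le_right _ _)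
    have hneU : U₁ ≠ U₀ := fun h => by
      subst h
      exact absurd (hφ₁.trans_le (min_le_left _ _)) (lt_irrefl _)
    have e₀ := hdim U₀ hU₀ hd₀ hφ₀
    have e₁ := hdim U₁ hU₁ hd₁ hφ₁'
    have hlt : U₀ ⊓ U₁ < U₀ := lt_of_le_of_ne inf_le_left fun h => hneU
      (Submodule.eq_of_le_of_finrank_eq (inf_eq_left.1 h) (by omega)).symm
    have h1 := hmin (U₀ ⊓ U₁) (hlt.trans hU₀)
      (by rw [← e₀]; exact Submodule.finrank_lt_finrank_of_lt hlt)
    have h2 := hφ0 (U₀ ⊔ U₁) (sup_le hU₀.le hU₁.le)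
    have h3 := hφmod U₀ U₁
    linarith
  refine ⟨U₀, hU₀, μ, ?_, fun U hU => ?_, fun U hU hlt => ?_⟩
  · simp only [φ] at hU₀φ
    linarith
  · have := hφ0 U hU
    simp only [φ] at this
    linarith
  · have := hmin U hU (by rw [← hdim U₀ hU₀ hd₀ hφ₀]; exact hlt)
    simp only [φ] at this
    linarith

theorem exists_HNChain (hf : ∀ U W, f U + f W ≤ f (U ⊓ W) + f (U ⊔ W))
    (hb : BddAbove (Set.range f)) (W : Submodule K V) : ∃ r w μ, HNChain f W r w μ := by
  by_cases hW : W = ⊥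
  · exact ⟨0, fun _ => ⊥, fun _ => 0, hW.symm, rfl, antitone_const, fun k hk => absurd hk (by omega),
      fun k hk => absurd hk (by omega), fun k hk => absurd hk (by omega),
      fun k hk => absurd hk (by omega)⟩
  · obtain ⟨W', hW', μ₀, h1, h2, h3⟩ := exists_maximal_slope hf hb hW
    have hlt := Submodule.finrank_lt_finrank_of_lt hW'
    obtain ⟨r, w, μ, h⟩ := exists_HNChain hf hb W'
    refine ⟨r + 1, fun k => k.casesOn W w, fun k => k.casesOn μ₀ μ, rfl, h.last,
      antitone_nat_of_succ_le fun k => ?_, fun k hk => ?_, fun k hk => ?_, fun k hk U => ?_,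
      fun k hk => ?_⟩
    · cases k with
      | zero => exact h.zero.trans_le hW'.le
      | succ k => exact h.anti k.le_succ
    · cases k with
      | zero => exact h.zero.trans_lt hW'
      | succ k => exact h.strict k (by omega)
    · cases k with
      | zero =>
        change f (w 0) - f W = μ₀ * (finrank K W - finrank K (w 0))
        rw [h.zero]
        exact h1
      | succ k => exact h.slope k (by omega)
    · cases k with
      | zero => exact fun _ hU => h2 U hU
      | succ k => exact h.semistable k (by omega) U
    · cases k with
      | zero =>
        have hr : 0 < r := by omega
        have hs := h.strict 0 hr
        have e1 := h.slope 0 hr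
        rw [h.zero] at hs e1
        have hd := Submodule.finrank_lt_finrank_of_lt hs
        have e2 := h3 (w (0 + 1)) (hs.trans hW') hd
        have hd' : (finrank K (w (0 + 1)) : ℝ) < finrank K W' := by exact_mod_cast hd
        change μ 0 < μ₀
        -- Otherwise the next term would reach the slope `μ₀` with smaller dimension than `W'`.
        by_contra hcon
        rw [not_lt] at hcon
        nlinarith
      | succ k => exact h.decreasing k (by omega)
termination_by finrank K W

/-! ### Support lines of the Harder–Narasimhan polygon -/

namespace HNChain

variable {r : ℕ} {w : ℕ → Submodule K V} {μ : ℕ → ℝ}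

/-- Supermodularity for `U ⊓ w k` and `w (k + 1)` reduces this to semistability of the step, tested
on their sum. -/
lemma step (h : HNChain f ⊤ r w μ) (hf : ∀ U W, f U + f W ≤ f (U ⊓ W) + f (U ⊔ W)) {k : ℕ}
    (hk : k < r) (U : Submodule K V) :
    f (U ⊓ w k) - f (U ⊓ w (k + 1)) ≤
      -(μ k * (finrank K ↥(U ⊓ w k) - finrank K ↥(U ⊓ w (k + 1)))) := by
  have hle : w (k + 1) ≤ w k := h.anti k.le_succ
  have h1 := hf (U ⊓ w k) (w (k + 1))
  have h2 := Submodule.finrank_sup_add_finrank_inf_eq (U ⊓ w k) (w (k + 1))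
  rw [inf_assoc, inf_eq_right.2 hle] at h1 h2
  have h3 := h.semistable k hk ((U ⊓ w k) ⊔ w (k + 1)) le_sup_right (sup_le inf_le_right hle)
  have h4 := h.slope k hk
  have h5 : (finrank K ↥((U ⊓ w k) ⊔ w (k + 1)) : ℝ) =
      finrank K ↥(U ⊓ w k) + finrank K (w (k + 1)) - finrank K ↥(U ⊓ w (k + 1)) := by
    rw [eq_sub_iff_add_eq]
    exact_mod_cast h2
  rw [h5] at h3
  linarith

lemma finrank_inf_le (h : HNChain f ⊤ r w μ) (k : ℕ) (U : Submodule K V) :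
    (finrank K ↥(U ⊓ w (k + 1)) : ℝ) ≤ finrank K ↥(U ⊓ w k) := by
  exact_mod_cast Submodule.finrank_mono (inf_le_inf_left U (h.anti k.le_succ))

lemma finrank_inf_sub_le (h : HNChain f ⊤ r w μ) (k : ℕ) (U : Submodule K V) :
    (finrank K ↥(U ⊓ w k) : ℝ) - finrank K ↥(U ⊓ w (k + 1)) ≤
      finrank K (w k) - finrank K (w (k + 1)) := by
  have hle : w (k + 1) ≤ w k := h.anti k.le_succ
  have h2 := Submodule.finrank_sup_add_finrank_inf_eq (U ⊓ w k) (w (k + 1))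
  rw [inf_assoc, inf_eq_right.2 hle] at h2
  have h3 := Submodule.finrank_mono (sup_le inf_le_right hle : (U ⊓ w k) ⊔ w (k + 1) ≤ w k)
  have h4 : (finrank K ↥(U ⊓ w k) : ℝ) + finrank K (w (k + 1)) ≤
      finrank K (w k) + finrank K ↥(U ⊓ w (k + 1)) := by
    exact_mod_cast (by omega : finrank K ↥(U ⊓ w k) + finrank K (w (k + 1)) ≤
      finrank K (w k) + finrank K ↥(U ⊓ w (k + 1)))
  linarith

/-- Telescopes `step` above `w j`; `inf_sub_le` does the same below it. Each replaces the slopes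
involved by the common bound `t`. -/
lemma sub_inf_le (h : HNChain f ⊤ r w μ) (hf : ∀ U W, f U + f W ≤ f (U ⊓ W) + f (U ⊔ W)) {t : ℝ} :
    ∀ {j : ℕ}, j ≤ r → (∀ k < j, t ≤ μ k) → ∀ U : Submodule K V,
    f U - f (U ⊓ w j) ≤ -(t * (finrank K U - finrank K ↥(U ⊓ w j)))
  | 0, _, _, U => by rw [h.zero, inf_top_eq]; simp
  | j + 1, hj, ht, U => by
    have h1 := sub_inf_le h hf (Nat.le_of_succ_le hj) (fun k hk => ht k (by omega)) U
    have h2 := h.step hf (Nat.lt_of_succ_le hj) U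
    have h3 := ht j j.lt_succ_self
    have h4 := h.finrank_inf_le j U
    nlinarith

lemma inf_sub_le (h : HNChain f ⊤ r w μ) (hf : ∀ U W, f U + f W ≤ f (U ⊓ W) + f (U ⊔ W)) {t : ℝ}
    {j : ℕ} (hj : j ≤ r) (ht : ∀ k, j ≤ k → k < r → μ k ≤ t) (U : Submodule K V) :
    f (U ⊓ w j) - f (w j) ≤ t * (finrank K (w j) - finrank K ↥(U ⊓ w j)) := by
  induction hj using Nat.decreasingInduction with
  | self => rw [h.last, inf_bot_eq]; simp
  | of_succ j hj ih =>
    have h1 := ih fun k hk => ht k (by omega)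
    have h2 := h.step hf hj U
    have h3 := ht j le_rfl hj
    have h4 := h.finrank_inf_sub_le j U
    have h5 := h.slope j hj
    nlinarith

theorem sub_le (h : HNChain f ⊤ r w μ) (hf : ∀ U W, f U + f W ≤ f (U ⊓ W) + f (U ⊔ W)) {t : ℝ}
    {j : ℕ} (hj : j ≤ r) (h₁ : ∀ k < j, t ≤ μ k) (h₂ : ∀ k, j ≤ k → k < r → μ k ≤ t)
    (U : Submodule K V) : f U - f (w j) ≤ t * (finrank K (w j) - finrank K U) := by
  have h1 := h.sub_inf_le hf hj h₁ U
  have h2 := h.inf_sub_le hf hj h₂ U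
  linarith

/-- With `t` strictly between the slopes on either side of the vertex, equality leaves no room for
`U ⊓ w j` to have smaller dimension than `U` or `w j`. -/
theorem eq_of_le_sub (h : HNChain f ⊤ r w μ) (hf : ∀ U W, f U + f W ≤ f (U ⊓ W) + f (U ⊔ W))
    {t t₁ t₂ : ℝ} (ht₁ : t₁ < t) (ht₂ : t < t₂) {j : ℕ} (hj : j ≤ r) (h₁ : ∀ k < j, t₂ ≤ μ k)
    (h₂ : ∀ k, j ≤ k → k < r → μ k ≤ t₁) {U : Submodule K V}
    (hU : t * (finrank K (w j) - finrank K U) ≤ f U - f (w j)) : U = w j := by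
  have h1 := h.sub_inf_le hf hj h₁ U
  have h2 := h.inf_sub_le hf hj h₂ U
  have hle1 : (finrank K ↥(U ⊓ w j) : ℝ) ≤ finrank K U := by
    exact_mod_cast Submodule.finrank_mono inf_le_left
  have hle2 : (finrank K ↥(U ⊓ w j) : ℝ) ≤ finrank K (w j) := by
    exact_mod_cast Submodule.finrank_mono inf_le_right
  have e1 : (finrank K ↥(U ⊓ w j) : ℝ) = finrank K U := by
    by_contra hne
    have := lt_of_le_of_ne hle1 hne
    nlinarith
  have e2 : (finrank K ↥(U ⊓ w j) : ℝ) = finrank K (w j) := by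
    by_contra hne
    have := lt_of_le_of_ne hle2 hne
    nlinarith
  have i1 := Submodule.eq_of_le_of_finrank_eq (inf_le_left : U ⊓ w j ≤ U) (by exact_mod_cast e1)
  have i2 := Submodule.eq_of_le_of_finrank_eq (inf_le_right : U ⊓ w j ≤ w j) (by exact_mod_cast e2)
  exact i1.symm.trans i2

omit [FiniteDimensional K V] in
lemma slope_lt (h : HNChain f ⊤ r w μ) {k l : ℕ} (hkl : k < l) (hl : l < r) : μ l < μ k := by
  induction l, hkl using Nat.le_induction with
  | base => exact h.decreasing k hl
  | succ l hkl ih => exact (h.decreasing l hl).trans (ih (by omega))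

omit [FiniteDimensional K V] in
lemma exists_separating (h : HNChain f ⊤ r w μ) {j : ℕ} (hj : j ≤ r) :
    ∃ t₁ t₂ : ℝ, t₁ < t₂ ∧ (∀ k < j, t₂ ≤ μ k) ∧ ∀ k, j ≤ k → k < r → μ k ≤ t₁ := by
  have hle : ∀ {k l : ℕ}, k ≤ l → l < r → μ l ≤ μ k := fun {k l} hkl hl => by
    rcases hkl.eq_or_lt with rfl | hkl
    · exact le_rfl
    · exact (h.slope_lt hkl hl).le
  rcases Nat.eq_zero_or_pos j with rfl | hj0
  -- At the two ends of the chain one condition is vacuous, so a gap of 1 can be chosen freely.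
  · exact ⟨μ 0, μ 0 + 1, lt_add_one _, fun k hk => absurd hk (by omega),
      fun k _ hk => hle (Nat.zero_le k) hk⟩
  · rcases hj.eq_or_lt with rfl | hjr
    · exact ⟨μ (j - 1) - 1, μ (j - 1), sub_one_lt _, fun k hk => hle (by omega) (by omega),
        fun k hk hk' => absurd hk (by omega)⟩
    · exact ⟨μ j, μ (j - 1), h.slope_lt (by omega) hjr, fun k hk => hle (by omega) (by omega),
        fun k hk hk' => hle hk hk'⟩

theorem exists_support (h : HNChain f ⊤ r w μ)
    (hf : ∀ U W, f U + f W ≤ f (U ⊓ W) + f (U ⊔ W)) {j : ℕ} (hj : j ≤ r) :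
    ∃ t : ℝ, (∀ U : Submodule K V, f U - f (w j) ≤ t * (finrank K (w j) - finrank K U)) ∧
      ∀ U : Submodule K V, t * (finrank K (w j) - finrank K U) ≤ f U - f (w j) → U = w j := by
  obtain ⟨t₁, t₂, hlt, h₁, h₂⟩ := h.exists_separating hj
  obtain ⟨t, ht₁, ht₂⟩ := exists_between hlt
  exact ⟨t, h.sub_le hf hj (fun k hk => ht₂.le.trans (h₁ k hk))
    (fun k hk hk' => (h₂ k hk hk').trans ht₁.le), fun U => h.eq_of_le_sub hf ht₁ ht₂ hj h₁ h₂⟩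

end HNChain

end HarderNarasimhan

/-! ### Compositions and parabolic subgroups -/

section Parabolic

open Module

variable {n : ℕ} {F : Type*} [Field F]

/-- Every partial sum of `Q` is one of `P`. -/
def Refines (P Q : Composition n) : Prop := ∀ k, ∃ l, P.sizeUpTo l = Q.sizeUpTo k

lemma Refines.index_le {P Q : Composition n} (h : Refines P Q) {i j : Fin n}
    (hij : P.index i ≤ P.index j) : Q.index i ≤ Q.index j := by
  obtain ⟨l, hl⟩ := h (Q.index i)
  have h1 := Q.sizeUpTo_index_le i
  rw [← hl, sizeUpTo_le_iff] at h1
  have h2 := (sizeUpTo_le_iff P).2 (h1.trans hij)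
  rw [hl] at h2
  exact (sizeUpTo_le_iff Q).1 h2

lemma refines_of_index_le {P Q : Composition n}
    (h : ∀ i j : Fin n, P.index i ≤ P.index j → Q.index i ≤ Q.index j) : Refines P Q := by
  intro k
  rcases Nat.eq_zero_or_pos (Q.sizeUpTo k) with h0 | h0
  · exact ⟨0, by rw [h0, P.sizeUpTo_zero]⟩
  rcases (Q.sizeUpTo_le k).eq_or_lt with hn | hn
  · exact ⟨P.length, by rw [hn, P.sizeUpTo_length]⟩
  -- The positions on either side of a break of `Q`. They lie in different blocks of `Q`, hence of
  -- `P`, so `P` breaks there too.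
  let i : Fin n := ⟨Q.sizeUpTo k - 1, by omega⟩
  let j : Fin n := ⟨Q.sizeUpTo k, hn⟩
  have hQ : Q.index i < Q.index j := by
    have h1 : k ≤ Q.index j := (sizeUpTo_le_iff Q).1 le_rfl
    have h2 : ¬ k ≤ Q.index i := fun hk => by
      have := (sizeUpTo_le_iff Q).2 hk
      simp only [i] at this
      omega
    exact Fin.lt_def.2 (by omega)
  have hP : P.index i < P.index j := lt_of_not_ge fun hle => absurd (h j i hle) (not_le.2 hQ)
  refine ⟨P.index j, ?_⟩
  have h1 := P.sizeUpTo_index_le j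
  have h2 : ¬ P.sizeUpTo (P.index j) ≤ i := fun hle => by
    have := (sizeUpTo_le_iff P).1 hle
    exact absurd hP (not_lt.2 this)
  simp only [i, j] at h1 h2 ⊢
  omega

lemma Refines.antisymm {P Q : Composition n} (h : Refines P Q) (h' : Refines Q P) : P = Q := by
  have mem : ∀ (R : Composition n) (x : Fin (n + 1)),
      x ∈ R.boundaries ↔ ∃ k, R.sizeUpTo k = x := by
    intro R x
    simp only [Composition.boundaries, Finset.mem_map, Finset.mem_univ, true_and]
    constructor
    · rintro ⟨k, rfl⟩
      exact ⟨k, rfl⟩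
    · rintro ⟨k, hk⟩
      rcases le_total k R.length with hle | hle
      · exact ⟨⟨k, by omega⟩, Fin.ext hk⟩
      · refine ⟨Fin.last _, Fin.ext ?_⟩
        rw [← hk, R.sizeUpTo_ofLength_le k hle]
        exact R.sizeUpTo_length
  refine (compositionEquiv n).injective (CompositionAsSet.ext ?_)
  change P.boundaries = Q.boundaries
  ext x
  rw [mem, mem]
  constructor
  · rintro ⟨k, hk⟩
    obtain ⟨l, hl⟩ := h' k
    exact ⟨l, hl.trans hk⟩
  · rintro ⟨k, hk⟩
    obtain ⟨l, hl⟩ := h k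
    exact ⟨l, hl.trans hk⟩

lemma Refines.parabolic_le {P Q : Composition n} (h : Refines P Q) :
    parabolic P F ≤ parabolic Q F := fun _ hg _ _ hij =>
  hg (lt_of_not_ge fun hle => absurd (h.index_le hle) (not_le.2 hij))

/-- Tested on transvections, one for each matrix position allowed in `P`. -/
lemma refines_of_parabolic_le {P Q : Composition n} (h : parabolic P F ≤ parabolic Q F) :
    Refines P Q := by
  refine refines_of_index_le fun i j hij => ?_
  rcases eq_or_ne i j with rfl | hne
  · exact le_rfl
  let g : GL (Fin n) F := GeneralLinearGroup.mk'' (transvection i j 1)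
    (by rw [det_transvection_of_ne i j hne]; exact isUnit_one)
  have hg : g ∈ parabolic P F := blockTriangular_transvection hij 1
  by_contra hlt
  have h1 : transvection i j (1 : F) i j = 0 := h hg (not_le.1 hlt)
  simp [transvection, hne] at h1

/-- `P(F)` is the stabilizer of the standard flag, so its cosets are flags. -/
lemma mem_parabolic_iff (P : Composition n) (δ' δ : GL (Fin n) F) :
    δ' * δ⁻¹ ∈ parabolic P F ↔
      ∀ k, rowSpan δ' (P.sizeUpTo k) = rowSpan δ (P.sizeUpTo k) := by
  constructor
  · intro h k
    refine Submodule.eq_of_le_of_finrank_eq ?_ (by rw [finrank_rowSpan, finrank_rowSpan])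
    refine Submodule.span_le.2 (Set.range_subset_iff.2 fun i => ?_)
    refine (row_mem_rowSpan_iff δ' δ _ i.1).2 fun j hj => h ?_
    have h1 := (sizeUpTo_le_iff P).1 i.2
    have h2 := (sizeUpTo_le_iff P).not.1 (not_le.2 hj)
    exact Fin.lt_def.2 (by omega)
  · intro h i j hij
    have h1 : (δ' : Matrix (Fin n) (Fin n) F) i ∈ rowSpan δ (P.sizeUpTo (P.index i)) := by
      rw [← h]
      exact row_mem_rowSpan δ' (P.sizeUpTo_index_le i)
    exact (row_mem_rowSpan_iff δ' δ _ i).1 h1 j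
      (not_le.1 fun hle => absurd hij (not_lt.2 ((sizeUpTo_le_iff P).1 hle)))

lemma exists_composition (r : ℕ) (c : ℕ → ℕ) (h0 : c 0 = 0) (hr : c r = n)
    (hc : ∀ k < r, c k < c (k + 1)) :
    ∃ P : Composition n, P.length = r ∧ ∀ k ≤ r, P.sizeUpTo k = c k := by
  have htake : ∀ k ≤ r, (((List.range r).map fun k => c (k + 1) - c k).take k).sum = c k := by
    intro k hk
    induction k with
    | zero => simp [h0]
    | succ k ih =>
      rw [List.sum_take_succ _ _ (by simpa using hk), ih (by omega)]
      have := hc k (by omega)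
      simp only [List.getElem_map, List.getElem_range]
      omega
  refine ⟨⟨(List.range r).map fun k => c (k + 1) - c k, ?_, ?_⟩, ?_, ?_⟩
  · intro i hi
    simp only [List.mem_map, List.mem_range] at hi
    obtain ⟨k, hk, rfl⟩ := hi
    have := hc k hk
    omega
  · have := htake r le_rfl
    rw [List.take_of_length_le (by simp), hr] at this
    exact this
  · simp [Composition.length]
  · exact htake

lemma exists_composition_GL (w : ℕ → Submodule F (Fin n → F)) (r : ℕ) (hw : Antitone w)
    (h0 : w 0 = ⊤) (hr : w r = ⊥) (hs : ∀ k < r, w (k + 1) < w k) :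
    ∃ (P : Composition n) (δ : GL (Fin n) F), P.length = r ∧
      (∀ k ≤ r, P.sizeUpTo k = n - finrank F (w k)) ∧
      ∀ k ≤ r, rowSpan δ (P.sizeUpTo k) = w k := by
  obtain ⟨δ, hδ⟩ := exists_GL_chain w hw r hr
  obtain ⟨P, hP, hk⟩ := exists_composition (n := n) r (fun k => n - finrank F (w k))
    (by rw [h0, finrank_top]; simp) (by rw [hr, finrank_bot]; simp)
    fun k hk => by
      have h1 := Submodule.finrank_lt_finrank_of_lt (hs k hk)
      have h2 : finrank F (w k) ≤ n := by simpa using Submodule.finrank_le (w k)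
      omega
  exact ⟨P, δ, hP, hk, fun k hk' => by rw [hk k hk', hδ k hk']⟩

end Parabolic

/-! ### Polygons -/

section Polygon

open Module

variable {n : ℕ}

/-- The partial sums of the vector `H`. -/
def polygon (H : Fin n → ℝ) (c : ℕ) : ℝ :=
  ∑ j ∈ Finset.range c, if h : j < n then H ⟨j, h⟩ else 0

lemma polygon_eq_sum_filter (H : Fin n → ℝ) {c : ℕ} (hc : c ≤ n) :
    polygon H c = ∑ i ∈ Finset.univ.filter fun i : Fin n => (i : ℕ) < c, H i := by
  have : Finset.range c = (Finset.univ.filter fun i : Fin n => (i : ℕ) < c).map Fin.valEmbedding := by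
    ext j
    simp only [Finset.mem_range, Finset.mem_map, Finset.mem_filter, Finset.mem_univ, true_and]
    exact ⟨fun h => ⟨⟨j, by omega⟩, h, rfl⟩, fun ⟨i, h, hi⟩ => hi ▸ h⟩
  rw [polygon, this, Finset.sum_map]
  exact Finset.sum_congr rfl fun i _ => by simp

/-- The sum of the values of the polygon at the integers. -/
def area (H : Fin n → ℝ) : ℝ := ∑ c ∈ Finset.range n, polygon H c

lemma sum_sum_sub_eq (h : ℕ → ℝ) (m : ℕ) :
    ∑ j ∈ Finset.range m, ∑ i ∈ Finset.range j, (h i - h j) =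
      2 * ∑ c ∈ Finset.range m, ∑ i ∈ Finset.range c, h i -
        ((m : ℝ) - 1) * ∑ i ∈ Finset.range m, h i := by
  induction m with
  | zero => simp
  | succ m ih =>
    rw [Finset.sum_range_succ, ih, Finset.sum_range_succ (fun c => ∑ i ∈ Finset.range c, h i),
      Finset.sum_range_succ (fun i => h i) m, Finset.sum_sub_distrib]
    simp only [Finset.sum_const, Finset.card_range, nsmul_eq_mul]
    push_cast
    ring

/-- Summation by parts: twice the pairing with `ρ` is twice the area, up to a term depending only on
the endpoint of the polygon. -/
lemma sum_lt_sub_eq (H : Fin n → ℝ) :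
    ∑ i : Fin n, ∑ j : Fin n, (if i < j then H i - H j else 0) =
      2 * area H - ((n : ℝ) - 1) * polygon H n := by
  let h : ℕ → ℝ := fun j => if hj : j < n then H ⟨j, hj⟩ else 0
  have hh : ∀ i : Fin n, h i = H i := fun i => by simp [h]
  have key : ∑ i : Fin n, ∑ j : Fin n, (if i < j then H i - H j else 0) =
      ∑ j ∈ Finset.range n, ∑ i ∈ Finset.range j, (h i - h j) := by
    rw [Finset.sum_comm, Finset.sum_range]
    refine Finset.sum_congr rfl fun j _ => ?_
    have : ∑ i ∈ Finset.range j, (h i - h j) =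
        ∑ i ∈ Finset.range n, if i < (j : ℕ) then h i - h j else 0 := by
      rw [← Finset.sum_filter]
      refine Finset.sum_congr ?_ fun _ _ => rfl
      ext i
      have := j.2
      simp only [Finset.mem_range, Finset.mem_filter]
      omega
    rw [this, Finset.sum_range]
    exact Finset.sum_congr rfl fun i _ => by simp only [hh, Fin.lt_def]
  rw [key, sum_sum_sub_eq]
  rfl

/-- The sum of `H i - H j` over the pairs `(i, j)` in distinct increasing blocks. -/
def pairSum (P : Composition n) (H : Fin n → ℝ) : ℝ :=
  ∑ i : Fin n, ∑ j : Fin n, if P.index i < P.index j then H i - H j else 0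

lemma pairSum_of_const (P : Composition n) (H : Fin n → ℝ)
    (hH : ∀ i j, P.index i = P.index j → H i = H j) :
    pairSum P H = 2 * area H - ((n : ℝ) - 1) * polygon H n := by
  rw [← sum_lt_sub_eq]
  refine Finset.sum_congr rfl fun i _ => Finset.sum_congr rfl fun j _ => ?_
  by_cases hij : i < j
  · rw [if_pos hij]
    rcases (index_monotone P hij.le).eq_or_lt with h | h
    · rw [if_neg h.not_lt, hH i j h, sub_self]
    · rw [if_pos h]
  · rw [if_neg hij, if_neg (not_lt.2 (index_monotone P (not_lt.1 hij)))]

lemma sum_mul_index (Q : Composition n) (κ : Fin Q.length → ℝ) (H : Fin n → ℝ) :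
    ∑ i, κ (Q.index i) * H i =
      ∑ a, κ a * (polygon H (Q.sizeUpTo (a + 1)) - polygon H (Q.sizeUpTo a)) := by
  rw [← Finset.sum_fiberwise Finset.univ Q.index]
  refine Finset.sum_congr rfl fun a _ => ?_
  have hsplit : (Finset.univ.filter fun i : Fin n => (i : ℕ) < Q.sizeUpTo (a + 1)) =
      (Finset.univ.filter fun i : Fin n => (i : ℕ) < Q.sizeUpTo a) ∪
        Finset.univ.filter fun i : Fin n => Q.index i = a := by
    ext i
    have h1 := sizeUpTo_le_iff Q (k := a) (i := i)
    have h2 := sizeUpTo_le_iff Q (k := a + 1) (i := i)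
    simp only [Finset.mem_filter, Finset.mem_univ, true_and, Finset.mem_union, Fin.ext_iff]
    omega
  have hdisj : Disjoint (Finset.univ.filter fun i : Fin n => (i : ℕ) < Q.sizeUpTo a)
      (Finset.univ.filter fun i : Fin n => Q.index i = a) := by
    rw [Finset.disjoint_left]
    intro i hi hi'
    have h1 := sizeUpTo_le_iff Q (k := a) (i := i)
    simp only [Finset.mem_filter, Finset.mem_univ, true_and, Fin.ext_iff] at hi hi'
    omega
  rw [polygon_eq_sum_filter H (Q.sizeUpTo_le _), polygon_eq_sum_filter H (Q.sizeUpTo_le _), hsplit,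
    Finset.sum_union hdisj, add_sub_cancel_left, Finset.mul_sum]
  refine Finset.sum_congr rfl fun i hi => ?_
  rw [(Finset.mem_filter.1 hi).2]

/-- The coefficient of each `H i` depends only on the block of `i`, so only the block sums count. -/
lemma pairSum_congr (Q : Composition n) {H H' : Fin n → ℝ}
    (h : ∀ k, polygon H (Q.sizeUpTo k) = polygon H' (Q.sizeUpTo k)) :
    pairSum Q H = pairSum Q H' := by
  have key : ∀ H : Fin n → ℝ, pairSum Q H =
      ∑ i, (∑ j : Fin n, if Q.index i < Q.index j then (1 : ℝ) else 0) * H i -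
        ∑ i, (∑ j : Fin n, if Q.index j < Q.index i then (1 : ℝ) else 0) * H i := by
    intro H
    have h1 : pairSum Q H = ∑ i : Fin n, ∑ j : Fin n, (if Q.index i < Q.index j then H i else 0) -
        ∑ i : Fin n, ∑ j : Fin n, (if Q.index i < Q.index j then H j else 0) := by
      rw [pairSum, ← Finset.sum_sub_distrib]
      refine Finset.sum_congr rfl fun i _ => ?_
      rw [← Finset.sum_sub_distrib]
      refine Finset.sum_congr rfl fun j _ => ?_
      split_ifs <;> simp
    rw [h1]
    congr 1
    · exact Finset.sum_congr rfl fun i _ => by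
        simp only [Finset.sum_mul, ite_mul, one_mul, zero_mul]
    · rw [Finset.sum_comm]
      exact Finset.sum_congr rfl fun i _ => by
        simp only [Finset.sum_mul, ite_mul, one_mul, zero_mul]
  rw [key, key, sum_mul_index Q (fun a => ∑ j : Fin n, if a < Q.index j then (1 : ℝ) else 0),
    sum_mul_index Q (fun a => ∑ j : Fin n, if Q.index j < a then (1 : ℝ) else 0),
    sum_mul_index Q (fun a => ∑ j : Fin n, if a < Q.index j then (1 : ℝ) else 0),
    sum_mul_index Q (fun a => ∑ j : Fin n, if Q.index j < a then (1 : ℝ) else 0)]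
  simp only [h]

lemma rho_dotProduct (P Q : Composition n) (H : Fin n → ℝ) :
    rho P Q ⬝ᵥ H = (1 / 2) * ∑ i : Fin n, ∑ j : Fin n,
      if P.index i < P.index j ∧ Q.index i = Q.index j then H i - H j else 0 := by
  rw [rho, smul_dotProduct, sum_dotProduct, smul_eq_mul]
  congr 1
  refine Finset.sum_congr rfl fun i _ => ?_
  rw [sum_dotProduct]
  refine Finset.sum_congr rfl fun j _ => ?_
  split_ifs
  · rw [sub_dotProduct, single_one_dotProduct, single_one_dotProduct]
  · rw [zero_dotProduct]

/-- The roots in `N_P ∩ M_Q` are those of `N_P` that are not in `N_Q`. -/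
lemma Refines.rho_dotProduct_eq {P Q : Composition n} (h : Refines P Q) (H : Fin n → ℝ) :
    rho P Q ⬝ᵥ H = (1 / 2) * (pairSum P H - pairSum Q H) := by
  rw [rho_dotProduct, pairSum, pairSum, ← Finset.sum_sub_distrib]
  congr 1
  refine Finset.sum_congr rfl fun i _ => ?_
  rw [← Finset.sum_sub_distrib]
  refine Finset.sum_congr rfl fun j _ => ?_
  by_cases hP : P.index i < P.index j
  · rcases (h.index_le hP.le).eq_or_lt with hQ | hQ
    · rw [if_pos ⟨hP, hQ⟩, if_pos hP, if_neg hQ.not_lt, sub_zero]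
    · rw [if_neg fun hh => hQ.ne hh.2, if_pos hP, if_pos hQ, sub_self]
  · rw [if_neg fun hh => hP hh.1, if_neg hP, if_neg (not_lt.2 (h.index_le (not_lt.1 hP))), sub_zero]

/-! ### The polygon of a flag -/

variable {F : Type*} [Field F] {f : Submodule F (Fin n → F) → ℝ}

/-- The slope of `f` on the `k`-th step of the flag given by `P` and `δ`. -/
def slopeAt (f : Submodule F (Fin n → F) → ℝ) (P : Composition n) (δ : GL (Fin n) F) (k : ℕ) : ℝ :=
  (f (rowSpan δ (P.sizeUpTo (k + 1))) - f (rowSpan δ (P.sizeUpTo k))) /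
    ((P.sizeUpTo (k + 1) : ℝ) - P.sizeUpTo k)

/-- The vector of the slopes of `f` on the flag given by `P` and `δ`. -/
def slopeVec (f : Submodule F (Fin n → F) → ℝ) (P : Composition n) (δ : GL (Fin n) F) :
    Fin n → ℝ := fun i => slopeAt f P δ (P.index i)

lemma harishChandra_eq [NumberField F] (P : Composition n) (δ : GL (Fin n) F)
    (g : GL (Fin n) (Adele F)) :
    harishChandra P (rat δ * g) = slopeVec (quotHeight g) P δ := by
  ext i
  rw [harishChandra_apply, slopeVec, slopeAt, sizeUpTo_succ_eq]
  push_cast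
  rw [add_sub_cancel_left]

lemma slopeVec_congr {P : Composition n} {δ' δ : GL (Fin n) F} (h : δ' * δ⁻¹ ∈ parabolic P F) :
    slopeVec f P δ' = slopeVec f P δ := by
  ext i
  simp only [slopeVec, slopeAt, (mem_parabolic_iff P δ' δ).1 h]

lemma sizeUpTo_sub_pos (P : Composition n) {k : ℕ} (hk : k < P.length) :
    (0 : ℝ) < (P.sizeUpTo (k + 1) : ℝ) - P.sizeUpTo k :=
  sub_pos.2 (by exact_mod_cast P.sizeUpTo_strict_mono hk)

lemma slopeAt_mul {P : Composition n} (δ : GL (Fin n) F) {k : ℕ} (hk : k < P.length) :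
    slopeAt f P δ k * ((P.sizeUpTo (k + 1) : ℝ) - P.sizeUpTo k) =
      f (rowSpan δ (P.sizeUpTo (k + 1))) - f (rowSpan δ (P.sizeUpTo k)) :=
  div_mul_cancel₀ _ (sizeUpTo_sub_pos P hk).ne'

lemma polygon_add_of_le (P : Composition n) (δ : GL (Fin n) F) {k c : ℕ}
    (hc : P.sizeUpTo k ≤ c) (hc' : c ≤ P.sizeUpTo (k + 1)) :
    polygon (slopeVec f P δ) c = polygon (slopeVec f P δ) (P.sizeUpTo k) +
      slopeAt f P δ k * ((c : ℝ) - P.sizeUpTo k) := by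
  induction c, hc using Nat.le_induction with
  | base => simp
  | succ c hc ih =>
    have hcn : c < n := (Nat.lt_of_succ_le hc').trans_le (P.sizeUpTo_le _)
    have hidx : (P.index ⟨c, hcn⟩ : ℕ) = k := by
      have h1 := (sizeUpTo_le_iff P (i := ⟨c, hcn⟩)).1 hc
      have h2 := (sizeUpTo_le_iff P (k := k + 1) (i := ⟨c, hcn⟩)).not.1 (by simp only; omega)
      omega
    have hstep : polygon (slopeVec f P δ) (c + 1) =
        polygon (slopeVec f P δ) c + slopeAt f P δ k := by
      rw [polygon, Finset.sum_range_succ, dif_pos hcn, ← polygon, slopeVec, hidx]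
    rw [hstep, ih (by omega)]
    push_cast
    ring

lemma polygon_sizeUpTo (hf₀ : f ⊤ = 0) (P : Composition n) (δ : GL (Fin n) F) (k : ℕ) :
    polygon (slopeVec f P δ) (P.sizeUpTo k) = f (rowSpan δ (P.sizeUpTo k)) := by
  induction k with
  | zero => simp [P.sizeUpTo_zero, polygon, rowSpan_zero, hf₀]
  | succ k ih =>
    rcases lt_or_ge k P.length with hk | hk
    · rw [polygon_add_of_le P δ (P.monotone_sizeUpTo k.le_succ) le_rfl, slopeAt_mul δ hk, ih]
      ring
    · rw [P.sizeUpTo_ofLength_le _ hk] at ih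
      rw [P.sizeUpTo_ofLength_le _ (hk.trans k.le_succ), ih]

lemma polygon_eq (hf₀ : f ⊤ = 0) (P : Composition n) (δ : GL (Fin n) F) {k c : ℕ}
    (hc : P.sizeUpTo k ≤ c) (hc' : c ≤ P.sizeUpTo (k + 1)) :
    polygon (slopeVec f P δ) c = f (rowSpan δ (P.sizeUpTo k)) +
      slopeAt f P δ k * ((c : ℝ) - P.sizeUpTo k) := by
  rw [polygon_add_of_le P δ hc hc', polygon_sizeUpTo hf₀]

lemma polygon_top (hf₀ : f ⊤ = 0) (P : Composition n) (δ : GL (Fin n) F) :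
    polygon (slopeVec f P δ) n = f ⊥ := by
  have := polygon_sizeUpTo hf₀ P δ P.length
  rwa [P.sizeUpTo_length, rowSpan_of_le δ le_rfl] at this

/-- On vectors constant on blocks, pairs within a block contribute nothing. Both polygons end at `f
⊥`, so the endpoint terms cancel and only areas remain. -/
theorem Refines.rho_dotProduct_slopeVec (hf₀ : f ⊤ = 0) {P Q : Composition n} (h : Refines P Q)
    (δ : GL (Fin n) F) :
    rho P Q ⬝ᵥ slopeVec f P δ = area (slopeVec f P δ) - area (slopeVec f Q δ) := by
  have hconst : ∀ (R : Composition n) (i j : Fin n), R.index i = R.index j →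
      slopeVec f R δ i = slopeVec f R δ j := fun R i j hij => by simp only [slopeVec, hij]
  have hQ : pairSum Q (slopeVec f P δ) = pairSum Q (slopeVec f Q δ) := by
    refine pairSum_congr Q fun k => ?_
    obtain ⟨l, hl⟩ := h k
    rw [polygon_sizeUpTo hf₀, ← hl, polygon_sizeUpTo hf₀]
  rw [h.rho_dotProduct_eq, hQ, pairSum_of_const P _ (hconst P), pairSum_of_const Q _ (hconst Q),
    polygon_top hf₀, polygon_top hf₀]
  ring

end Polygon

/-! ### Harder–Narasimhan pairs -/

section HNPair

open Module

variable {n : ℕ} {F : Type*} [Field F] {f : Submodule F (Fin n → F) → ℝ}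

lemma natCast_finrank_rowSpan (δ : GL (Fin n) F) {c : ℕ} (hc : c ≤ n) :
    (finrank F (rowSpan δ c) : ℝ) = n - c := by
  rw [finrank_rowSpan, Nat.cast_sub hc]

/-- The flag of `(P, δ)` is a Harder–Narasimhan chain for `f`. -/
def IsHNPair (f : Submodule F (Fin n → F) → ℝ) (P : Composition n) (δ : GL (Fin n) F) : Prop :=
  HNChain f ⊤ P.length (fun k => rowSpan δ (P.sizeUpTo k)) (slopeAt f P δ)

theorem exists_isHNPair (hf : ∀ U W, f U + f W ≤ f (U ⊓ W) + f (U ⊔ W))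
    (hb : BddAbove (Set.range f)) :
    ∃ (P : Composition n) (δ : GL (Fin n) F), IsHNPair f P δ := by
  obtain ⟨r, w, μ, h⟩ := exists_HNChain hf hb ⊤
  obtain ⟨P, δ, rfl, hsz, hw⟩ := exists_composition_GL w r h.anti h.zero h.last h.strict
  have hfun : (fun k => rowSpan δ (P.sizeUpTo k)) = w := by
    ext1 k
    rcases le_total k P.length with hk | hk
    · exact hw k hk
    · rw [P.sizeUpTo_ofLength_le k hk, rowSpan_of_le δ le_rfl]
      exact (le_bot_iff.1 (h.last ▸ h.anti hk)).symm
  have hμ : ∀ k < P.length, slopeAt f P δ k = μ k := fun k hk => by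
    have h1 := h.slope k hk
    rw [← hfun, natCast_finrank_rowSpan δ (P.sizeUpTo_le _),
      natCast_finrank_rowSpan δ (P.sizeUpTo_le _)] at h1
    rw [slopeAt, h1, div_eq_iff (sizeUpTo_sub_pos P hk).ne']
    ring
  refine ⟨P, δ, ?_⟩
  rw [IsHNPair, hfun]
  exact ⟨h.zero, h.last, h.anti, h.strict, fun k hk => by rw [hμ k hk]; exact h.slope k hk,
    fun k hk => by rw [hμ k hk]; exact h.semistable k hk,
    fun k hk => by rw [hμ k (by omega), hμ (k + 1) hk]; exact h.decreasing k hk⟩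

lemma IsHNPair.congr {P : Composition n} {δ' δ : GL (Fin n) F} (h : IsHNPair f P δ)
    (hδ : δ' * δ⁻¹ ∈ parabolic P F) : IsHNPair f P δ' := by
  have h1 := (mem_parabolic_iff P δ' δ).1 hδ
  have h2 : slopeAt f P δ' = slopeAt f P δ := by
    ext k
    simp only [slopeAt, h1]
  unfold IsHNPair
  simp only [h1, h2]
  exact h

/-- Convex interpolation with denominators cleared, through which affine bounds on `f` pass to
polygons. -/
lemma sub_mul_add_mul_polygon (hf₀ : f ⊤ = 0) (P : Composition n) (δ : GL (Fin n) F) {c : ℕ}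
    (hc : c < n) : ∃ k < P.length, P.sizeUpTo k ≤ c ∧ c < P.sizeUpTo (k + 1) ∧
      ((P.sizeUpTo (k + 1) : ℝ) - P.sizeUpTo k) * polygon (slopeVec f P δ) c =
        ((P.sizeUpTo (k + 1) : ℝ) - c) * f (rowSpan δ (P.sizeUpTo k)) +
          ((c : ℝ) - P.sizeUpTo k) * f (rowSpan δ (P.sizeUpTo (k + 1))) := by
  have h1 := P.sizeUpTo_index_le ⟨c, hc⟩
  have h2 := P.lt_sizeUpTo_index_succ ⟨c, hc⟩
  refine ⟨P.index ⟨c, hc⟩, (P.index _).2, h1, h2, ?_⟩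
  have h3 := slopeAt_mul (f := f) (P := P) δ (P.index ⟨c, hc⟩).2
  rw [polygon_eq hf₀ P δ h1 h2.le]
  linear_combination ((c : ℝ) - P.sizeUpTo (P.index ⟨c, hc⟩)) * h3

lemma polygon_le_of_forall_le (hf₀ : f ⊤ = 0) {M t : ℝ}
    (h : ∀ U : Submodule F (Fin n → F), f U ≤ M + t * (n - finrank F U)) (P : Composition n)
    (δ : GL (Fin n) F) {c : ℕ} (hc : c ≤ n) : polygon (slopeVec f P δ) c ≤ M + t * c := by
  rcases hc.eq_or_lt with rfl | hc
  · rw [polygon_top hf₀]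
    simpa using h ⊥
  · obtain ⟨k, hk, h1, h2, h3⟩ := sub_mul_add_mul_polygon hf₀ P δ hc
    have hA := h (rowSpan δ (P.sizeUpTo k))
    have hB := h (rowSpan δ (P.sizeUpTo (k + 1)))
    rw [natCast_finrank_rowSpan δ (P.sizeUpTo_le _), sub_sub_cancel] at hA hB
    have hL := sizeUpTo_sub_pos P hk
    have h1' : (0 : ℝ) ≤ (c : ℝ) - P.sizeUpTo k := sub_nonneg.2 (by exact_mod_cast h1)
    have h2' : (0 : ℝ) ≤ (P.sizeUpTo (k + 1) : ℝ) - c := sub_nonneg.2 (by exact_mod_cast h2.le)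
    have h4 := mul_le_mul_of_nonneg_left hA h2'
    have h5 := mul_le_mul_of_nonneg_left hB h1'
    refine le_of_mul_le_mul_left ?_ hL
    linarith

lemma exists_sizeUpTo_eq (hf₀ : f ⊤ = 0) {M t : ℝ} {U₀ : Submodule F (Fin n → F)}
    (h : ∀ U : Submodule F (Fin n → F), f U ≤ M + t * (n - finrank F U))
    (h₀ : ∀ U : Submodule F (Fin n → F), M + t * (n - finrank F U) ≤ f U → U = U₀)
    (P : Composition n) (δ : GL (Fin n) F) {c : ℕ} (hc : c ≤ n)
    (hle : M + t * c ≤ polygon (slopeVec f P δ) c) :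
    ∃ k, P.sizeUpTo k = c ∧ rowSpan δ c = U₀ := by
  rcases hc.eq_or_lt with rfl | hc
  · refine ⟨P.length, P.sizeUpTo_length, h₀ _ ?_⟩
    rw [polygon_top hf₀] at hle
    rw [rowSpan_of_le δ le_rfl]
    simpa using hle
  · obtain ⟨k, hk, h1, h2, h3⟩ := sub_mul_add_mul_polygon hf₀ P δ hc
    have hA := h (rowSpan δ (P.sizeUpTo k))
    have hB := h (rowSpan δ (P.sizeUpTo (k + 1)))
    have hA₀ := h₀ (rowSpan δ (P.sizeUpTo k))
    have hB₀ := h₀ (rowSpan δ (P.sizeUpTo (k + 1)))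
    rw [natCast_finrank_rowSpan δ (P.sizeUpTo_le _), sub_sub_cancel] at hA hB hA₀ hB₀
    have hL := sizeUpTo_sub_pos P hk
    have h1' : (0 : ℝ) ≤ (c : ℝ) - P.sizeUpTo k := sub_nonneg.2 (by exact_mod_cast h1)
    have h2' : (0 : ℝ) < (P.sizeUpTo (k + 1) : ℝ) - c := sub_pos.2 (by exact_mod_cast h2)
    have h4 := mul_le_mul_of_nonneg_left hle hL.le
    have h5 := mul_le_mul_of_nonneg_left hB h1'
    have eA : rowSpan δ (P.sizeUpTo k) = U₀ := by
      refine hA₀ (le_of_mul_le_mul_left ?_ h2')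
      linarith
    rcases h1.eq_or_lt with h1 | h1
    · exact ⟨k, h1, h1 ▸ eA⟩
    -- A polygon meeting the line inside an edge meets it at both ends, which would then be the same
    -- subspace `U₀`.
    · exfalso
      have h1'' : (0 : ℝ) < (c : ℝ) - P.sizeUpTo k := sub_pos.2 (by exact_mod_cast h1)
      have h6 := mul_le_mul_of_nonneg_left hA h2'.le
      have eB : rowSpan δ (P.sizeUpTo (k + 1)) = U₀ := by
        refine hB₀ (le_of_mul_le_mul_left ?_ h1'')
        linarith
      have e := congrArg (fun W : Submodule F (Fin n → F) => finrank F W) (eA.trans eB.symm)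
      simp only [finrank_rowSpan] at e
      have := P.sizeUpTo_le (k + 1)
      omega

/-- The line carrying an edge of the Harder–Narasimhan polygon bounds `f` everywhere, hence bounds
every other polygon. -/
lemma IsHNPair.polygon_le {Q : Composition n} {γ : GL (Fin n) F} (h : IsHNPair f Q γ)
    (hf₀ : f ⊤ = 0) (hf : ∀ U W, f U + f W ≤ f (U ⊓ W) + f (U ⊔ W)) (P : Composition n)
    (δ : GL (Fin n) F) {c : ℕ} (hc : c ≤ n) :
    polygon (slopeVec f P δ) c ≤ polygon (slopeVec f Q γ) c := by
  rcases hc.eq_or_lt with rfl | hc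
  · rw [polygon_top hf₀, polygon_top hf₀]
  have h1 := Q.sizeUpTo_index_le ⟨c, hc⟩
  have h2 : c < Q.sizeUpTo ((Q.index ⟨c, hc⟩ : ℕ) + 1) := Q.lt_sizeUpTo_index_succ ⟨c, hc⟩
  have hk := (Q.index ⟨c, hc⟩).2
  generalize (Q.index ⟨c, hc⟩ : ℕ) = k at *
  rw [polygon_eq hf₀ Q γ h1 h2.le]
  have hsub := HNChain.sub_le h hf (t := slopeAt f Q γ k) hk.le
    (fun l hl => (HNChain.slope_lt h hl hk).le) (fun l hl hl' => by
      rcases hl.eq_or_lt with rfl | hl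
      · exact le_rfl
      · exact (HNChain.slope_lt h hl hl').le)
  have := polygon_le_of_forall_le hf₀ (t := slopeAt f Q γ k)
    (M := f (rowSpan γ (Q.sizeUpTo k)) - slopeAt f Q γ k * Q.sizeUpTo k) (fun U => by
      have h3 := hsub U
      rw [natCast_finrank_rowSpan γ (Q.sizeUpTo_le _)] at h3
      linarith) P δ hc.le
  linarith

lemma IsHNPair.area_le {Q : Composition n} {γ : GL (Fin n) F} (h : IsHNPair f Q γ)
    (hf₀ : f ⊤ = 0) (hf : ∀ U W, f U + f W ≤ f (U ⊓ W) + f (U ⊔ W)) (P : Composition n)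
    (δ : GL (Fin n) F) : area (slopeVec f P δ) ≤ area (slopeVec f Q γ) :=
  Finset.sum_le_sum fun _ hc => h.polygon_le hf₀ hf P δ (Finset.mem_range.1 hc).le

lemma exists_le_length_sizeUpTo_eq (P : Composition n) (k : ℕ) :
    ∃ l ≤ P.length, P.sizeUpTo l = P.sizeUpTo k := by
  rcases le_total k P.length with hk | hk
  · exact ⟨k, hk, rfl⟩
  · exact ⟨P.length, le_rfl, by rw [P.sizeUpTo_length, P.sizeUpTo_ofLength_le k hk]⟩

/-- Equal areas and pointwise domination make the polygons equal. The support line at each vertex of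
`Q` then forces the other flag through the same subspace. -/
lemma IsHNPair.refines_of_area_le {Q : Composition n} {γ : GL (Fin n) F} (h : IsHNPair f Q γ)
    (hf₀ : f ⊤ = 0) (hf : ∀ U W, f U + f W ≤ f (U ⊓ W) + f (U ⊔ W)) {P : Composition n}
    {δ : GL (Fin n) F} (hle : area (slopeVec f Q γ) ≤ area (slopeVec f P δ)) :
    Refines P Q ∧ δ * γ⁻¹ ∈ parabolic Q F := by
  have heq : ∀ c ≤ n, polygon (slopeVec f P δ) c = polygon (slopeVec f Q γ) c := by
    intro c hc
    rcases hc.eq_or_lt with rfl | hc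
    · rw [polygon_top hf₀, polygon_top hf₀]
    · exact (Finset.sum_eq_sum_iff_of_le fun c hc =>
        h.polygon_le hf₀ hf P δ (Finset.mem_range.1 hc).le).1
        (le_antisymm (h.area_le hf₀ hf P δ) hle) c (Finset.mem_range.2 hc)
  have key : ∀ j, (∃ k, P.sizeUpTo k = Q.sizeUpTo j) ∧
      rowSpan δ (Q.sizeUpTo j) = rowSpan γ (Q.sizeUpTo j) := by
    intro j
    obtain ⟨l, hl, hlj⟩ := exists_le_length_sizeUpTo_eq Q j
    obtain ⟨t, ht, ht'⟩ := HNChain.exists_support h hf hl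
    simp only [natCast_finrank_rowSpan γ (Q.sizeUpTo_le _), hlj] at ht ht'
    obtain ⟨k, hk, hk'⟩ := exists_sizeUpTo_eq hf₀ (t := t)
      (M := f (rowSpan γ (Q.sizeUpTo j)) - t * Q.sizeUpTo j) (U₀ := rowSpan γ (Q.sizeUpTo j))
      (fun U => by have := ht U; linarith) (fun U hU => ht' U (by linarith)) P δ
      (Q.sizeUpTo_le j) (by rw [heq _ (Q.sizeUpTo_le j), polygon_sizeUpTo hf₀]; linarith)
    exact ⟨⟨k, hk⟩, hk'⟩
  exact ⟨fun j => (key j).1, (mem_parabolic_iff Q δ γ).2 fun j => (key j).2⟩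

/-- Inserting a subspace above the polygon of a flag. -/
lemma exists_refinement_rho_pos {P : Composition n} {δ : GL (Fin n) F} {k : ℕ}
    (hk : k < P.length) {U : Submodule F (Fin n → F)} (h₁ : rowSpan δ (P.sizeUpTo (k + 1)) ≤ U)
    (h₂ : U ≤ rowSpan δ (P.sizeUpTo k))
    (hU : slopeAt f P δ k * ((finrank F (rowSpan δ (P.sizeUpTo k)) : ℝ) - finrank F U) <
      f U - f (rowSpan δ (P.sizeUpTo k))) :
    ∃ (P' : Composition n) (δ' : GL (Fin n) F), Refines P' P ∧ δ' * δ⁻¹ ∈ parabolic P F ∧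
      0 < rho P' P ⬝ᵥ slopeVec f P' δ' := by
  have hs := slopeAt_mul (f := f) (P := P) δ hk
  have hne₁ : U ≠ rowSpan δ (P.sizeUpTo (k + 1)) := by
    rintro rfl
    rw [natCast_finrank_rowSpan δ (P.sizeUpTo_le _), natCast_finrank_rowSpan δ (P.sizeUpTo_le _)]
      at hU
    linarith
  have hne₂ : U ≠ rowSpan δ (P.sizeUpTo k) := by
    rintro rfl
    simp at hU
  have hlt₁ := lt_of_le_of_ne h₁ hne₁.symm
  have hlt₂ := lt_of_le_of_ne h₂ hne₂
  have hstrict : ∀ l < P.length, rowSpan δ (P.sizeUpTo (l + 1)) < rowSpan δ (P.sizeUpTo l) := by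
    intro l hl
    refine lt_of_le_of_ne (rowSpan_antitone δ (P.monotone_sizeUpTo l.le_succ)) fun h => ?_
    have e := congrArg (fun W : Submodule F (Fin n → F) => finrank F W) h
    simp only [finrank_rowSpan] at e
    have h3 := P.sizeUpTo_strict_mono hl
    have h4 := P.sizeUpTo_le (l + 1)
    omega
  -- `U` is inserted at index `k + 1`, and the later terms are shifted by one.
  let w : ℕ → Submodule F (Fin n → F) := fun l =>
    if l ≤ k then rowSpan δ (P.sizeUpTo l)
    else if l = k + 1 then U else rowSpan δ (P.sizeUpTo (l - 1))
  have hwlow : ∀ l ≤ k, w l = rowSpan δ (P.sizeUpTo l) := fun l hl => if_pos hl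
  have hwmid : w (k + 1) = U := by simp [w]
  have hwhigh : ∀ l, k + 1 ≤ l → w (l + 1) = rowSpan δ (P.sizeUpTo l) := fun l hl => by
    simp only [w]
    rw [if_neg (by omega), if_neg (by omega), Nat.add_sub_cancel]
  have hwanti : Antitone w := by
    refine antitone_nat_of_succ_le fun l => ?_
    rcases lt_trichotomy l k with hl | rfl | hl
    · rw [hwlow _ hl, hwlow _ hl.le]
      exact rowSpan_antitone δ (P.monotone_sizeUpTo l.le_succ)
    · rw [hwmid, hwlow _ le_rfl]
      exact h₂
    · rw [hwhigh l hl]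
      obtain ⟨m, rfl⟩ : ∃ m, l = m + 1 := ⟨l - 1, by omega⟩
      rcases Nat.eq_or_lt_of_le (Nat.lt_succ_iff.1 hl) with rfl | hm
      · rw [hwmid]
        exact h₁
      · rw [hwhigh m hm]
        exact rowSpan_antitone δ (P.monotone_sizeUpTo m.le_succ)
  obtain ⟨P', δ', hlen, hsz, hrow⟩ := exists_composition_GL w (P.length + 1) hwanti
    (by rw [hwlow 0 (Nat.zero_le k), P.sizeUpTo_zero, rowSpan_zero])
    (by rw [hwhigh _ hk, P.sizeUpTo_length, rowSpan_of_le δ le_rfl]) (fun l hl => by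
      rcases lt_trichotomy l k with hlk | rfl | hlk
      · rw [hwlow _ hlk, hwlow _ hlk.le]
        exact hstrict l (by omega)
      · rw [hwmid, hwlow _ le_rfl]
        exact hlt₂
      · rw [hwhigh l hlk]
        obtain ⟨m, rfl⟩ : ∃ m, l = m + 1 := ⟨l - 1, by omega⟩
        rcases Nat.eq_or_lt_of_le (Nat.lt_succ_iff.1 hlk) with rfl | hm
        · rw [hwmid]
          exact hlt₁
        · rw [hwhigh m hm]
          exact hstrict m (by omega))
  have hfin : ∀ l, n - finrank F (rowSpan δ (P.sizeUpTo l)) = P.sizeUpTo l := fun l => by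
    rw [finrank_rowSpan]
    have := P.sizeUpTo_le l
    omega
  have hszlow : ∀ l ≤ k, P'.sizeUpTo l = P.sizeUpTo l := fun l hl => by
    rw [hsz l (by omega), hwlow l hl, hfin]
  have hszhigh : ∀ l, k + 1 ≤ l → l ≤ P.length → P'.sizeUpTo (l + 1) = P.sizeUpTo l :=
    fun l hl hl' => by rw [hsz (l + 1) (by omega), hwhigh l hl, hfin]
  have hszmid : P'.sizeUpTo (k + 1) = n - finrank F U := by rw [hsz (k + 1) (by omega), hwmid]
  have hbdry : ∀ l ≤ P.length, ∃ l' ≤ P.length + 1, P'.sizeUpTo l' = P.sizeUpTo l ∧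
      w l' = rowSpan δ (P.sizeUpTo l) := fun l hl => by
    rcases le_or_gt l k with hlk | hlk
    · exact ⟨l, by omega, hszlow l hlk, hwlow l hlk⟩
    · exact ⟨l + 1, by omega, hszhigh l hlk hl, hwhigh l hlk⟩
  have hUn : finrank F U ≤ n := by simpa using Submodule.finrank_le U
  have hUcast : ((n - finrank F U : ℕ) : ℝ) = n - finrank F U := Nat.cast_sub hUn
  have hk1 : P'.sizeUpTo k < P'.sizeUpTo (k + 1) := P'.sizeUpTo_strict_mono (by omega)
  have hk2 : P'.sizeUpTo (k + 1) < P'.sizeUpTo (k + 1 + 1) := P'.sizeUpTo_strict_mono (by omega)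
  have hpos₁ : (0 : ℝ) < ((n - finrank F U : ℕ) : ℝ) - P.sizeUpTo k := by
    rw [hszlow k le_rfl, hszmid] at hk1
    exact sub_pos.2 (by exact_mod_cast hk1)
  have hpos₂ : (0 : ℝ) < (P.sizeUpTo (k + 1) : ℝ) - (n - finrank F U : ℕ) := by
    rw [hszmid, hszhigh (k + 1) le_rfl hk] at hk2
    exact sub_pos.2 (by exact_mod_cast hk2)
  have hslope : slopeAt f P' δ' (k + 1) < slopeAt f P' δ' k := by
    have e1 : slopeAt f P' δ' k = (f U - f (rowSpan δ (P.sizeUpTo k))) /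
        (((n - finrank F U : ℕ) : ℝ) - P.sizeUpTo k) := by
      rw [slopeAt, hrow _ (by omega), hrow _ (by omega), hwmid, hwlow k le_rfl, hszmid,
        hszlow k le_rfl]
    have e2 : slopeAt f P' δ' (k + 1) = (f (rowSpan δ (P.sizeUpTo (k + 1))) - f U) /
        ((P.sizeUpTo (k + 1) : ℝ) - (n - finrank F U : ℕ)) := by
      rw [slopeAt, hrow _ (by omega), hrow _ (by omega), hwmid, hwhigh _ le_rfl, hszmid,
        hszhigh _ le_rfl hk]
    rw [natCast_finrank_rowSpan δ (P.sizeUpTo_le _)] at hU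
    have e3 : slopeAt f P δ k < slopeAt f P' δ' k := by
      rw [e1, lt_div_iff₀ hpos₁, hUcast]
      linarith
    have e4 : slopeAt f P' δ' (k + 1) < slopeAt f P δ k := by
      rw [e2, div_lt_iff₀ hpos₂, hUcast]
      linarith
    exact e4.trans e3
  -- Inside a block of `P`, the only possible break of `P'` is the new one. The pairing with `rho`
  -- thus involves only pairs across it, each contributing the positive drop in slope.
  have hmid : ∀ i j : Fin n, P.index i = P.index j → ∀ l ≤ P.length + 1, (i : ℕ) < P'.sizeUpTo l →
      P'.sizeUpTo l ≤ j → l = k + 1 := by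
    intro i j hij l hl hil hlj
    have hcon : ∀ m, P'.sizeUpTo l = P.sizeUpTo m → False := fun m hm => by
      rw [hm] at hil hlj
      rw [sizeUpTo_le_iff, ← hij, ← sizeUpTo_le_iff] at hlj
      omega
    by_contra hne
    rcases Nat.lt_or_ge l (k + 1) with hlk | hlk
    · exact hcon l (hszlow l (by omega))
    · obtain ⟨m, rfl⟩ : ∃ m, l = m + 1 := ⟨l - 1, by omega⟩
      exact hcon m (hszhigh m (by omega) (by omega))
  have hpair : ∀ i j : Fin n, P'.index i < P'.index j → P.index i = P.index j →
      (P'.index i : ℕ) = k ∧ (P'.index j : ℕ) = k + 1 := by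
    intro i j hij hPij
    have hij' : (P'.index i : ℕ) + 1 ≤ P'.index j := hij
    have hj := (P'.index j).2
    have a1 := hmid i j hPij (P'.index i + 1) (by omega)
      (not_le.1 fun hle => by have := (sizeUpTo_le_iff P').1 hle; omega)
      ((sizeUpTo_le_iff P').2 hij')
    have a2 := hmid i j hPij (P'.index j) (by omega)
      (not_le.1 fun hle => by have := (sizeUpTo_le_iff P').1 hle; omega)
      (P'.sizeUpTo_index_le j)
    omega
  refine ⟨P', δ', fun l => ?_, (mem_parabolic_iff P δ' δ).2 fun l => ?_, ?_⟩
  · obtain ⟨m, hm, hml⟩ := exists_le_length_sizeUpTo_eq P l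
    obtain ⟨l', -, h3, -⟩ := hbdry m hm
    exact ⟨l', h3.trans hml⟩
  · obtain ⟨m, hm, hml⟩ := exists_le_length_sizeUpTo_eq P l
    obtain ⟨l', hl', h3, h4⟩ := hbdry m hm
    rw [← hml, ← h3, hrow l' hl', h4, h3]
  · rw [rho_dotProduct]
    have hterm : ∀ i j : Fin n, 0 ≤ (if P'.index i < P'.index j ∧ P.index i = P.index j then
        slopeVec f P' δ' i - slopeVec f P' δ' j else 0) := by
      intro i j
      split_ifs with hij
      · obtain ⟨hi, hj⟩ := hpair i j hij.1 hij.2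
        simp only [slopeVec, hi, hj]
        linarith
      · exact le_rfl
    have hn1 : P'.sizeUpTo (k + 1) < n := hk2.trans_le (P'.sizeUpTo_le _)
    -- The first positions of the two new blocks supply one strictly positive term.
    let i : Fin n := ⟨P'.sizeUpTo k, hk1.trans hn1⟩
    let j : Fin n := ⟨P'.sizeUpTo (k + 1), hn1⟩
    have hi : (P'.index i : ℕ) = k := by
      have h3 := (sizeUpTo_le_iff P' (k := k) (i := i)).1 le_rfl
      have h4 := (sizeUpTo_le_iff P' (k := k + 1) (i := i)).not.1 (not_le.2 hk1)
      omega
    have hj : (P'.index j : ℕ) = k + 1 := by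
      have h3 := (sizeUpTo_le_iff P' (k := k + 1) (i := j)).1 le_rfl
      have h4 := (sizeUpTo_le_iff P' (k := k + 1 + 1) (i := j)).not.1 (not_le.2 hk2)
      omega
    have hPidx : ∀ i : Fin n, P.sizeUpTo k ≤ i → (i : ℕ) < P.sizeUpTo (k + 1) →
        (P.index i : ℕ) = k := fun i h3 h4 => by
      have h5 := (sizeUpTo_le_iff P).1 h3
      have h6 := (sizeUpTo_le_iff P).not.1 (not_le.2 h4)
      omega
    have hPi : (P.index i : ℕ) = k := by
      refine hPidx i (hszlow k le_rfl).ge ?_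
      rw [← hszhigh (k + 1) le_rfl hk]
      exact hk1.trans hk2
    have hPj : (P.index j : ℕ) = k := by
      refine hPidx j ?_ ?_
      · rw [← hszlow k le_rfl]
        exact hk1.le
      · rw [← hszhigh (k + 1) le_rfl hk]
        exact hk2
    refine mul_pos one_half_pos (Finset.sum_pos' (fun i _ => Finset.sum_nonneg fun j _ => hterm i j)
      ⟨i, Finset.mem_univ i, Finset.sum_pos' (fun j _ => hterm i j) ⟨j, Finset.mem_univ j, ?_⟩⟩)
    rw [if_pos ⟨Fin.lt_def.2 (by omega), Fin.ext (by omega)⟩]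
    simp only [slopeVec, hi, hj]
    linarith

end HNPair

/-! ### Canonical pairs and slopes -/

section Canonical

open Module

variable {n : ℕ} [NeZero n] {F : Type*} [Field F]

omit [NeZero n] in
lemma firstPart_le_self (P : Composition n) : firstPart P ≤ n := P.sizeUpTo_le 1

instance : Subsingleton (Fin (whole n).length) := by
  rw [whole, Composition.single_length]
  infer_instance

lemma refines_whole (P : Composition n) : Refines P (whole n) :=
  refines_of_index_le fun _ _ _ => (Subsingleton.elim _ _).le

lemma mem_parabolic_whole (δ : GL (Fin n) F) : δ ∈ parabolic (whole n) F := fun _ _ hij =>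
  absurd hij (by rw [Subsingleton.elim ((whole n).index _)]; exact lt_irrefl _)

lemma firstPart_pos (P : Composition n) : 0 < firstPart P := by
  have h := P.sizeUpTo_strict_mono (i := 0) (P.length_pos_iff.2 (NeZero.pos n))
  rwa [P.sizeUpTo_zero] at h

variable [NumberField F] (g : GL (Fin n) (Adele F))

/-- The subtracted area does not depend on `(P, δ)`: maximizing the degree means maximizing the
area. -/
lemma rho_whole_eq (P : Composition n) (δ : GL (Fin n) F) :
    rho P (whole n) ⬝ᵥ harishChandra P (rat δ * g) =
      area (slopeVec (quotHeight g) P δ) - area (slopeVec (quotHeight g) (whole n) 1) := by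
  rw [harishChandra_eq, (refines_whole P).rho_dotProduct_slopeVec (quotHeight_top g),
    slopeVec_congr (P := whole n) (δ' := δ) (δ := 1) (mem_parabolic_whole _)]

variable {g} {Q : Composition n} {γ : GL (Fin n) F}

lemma IsHNPair.instabilityDegree_eq (h : IsHNPair (quotHeight g) Q γ) :
    instabilityDegree (whole n) g =
      ((rho Q (whole n) ⬝ᵥ harishChandra Q (rat γ * g) : ℝ) : EReal) := by
  refine le_antisymm ?_ ?_
  · refine iSup_le fun P => iSup_le fun _ => iSup_le fun δ => EReal.coe_le_coe_iff.2 ?_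
    rw [rho_whole_eq, rho_whole_eq]
    exact sub_le_sub_right (h.area_le (quotHeight_top g) (quotHeight_add_le g) P δ) _
  · exact le_iSup_of_le Q (le_iSup_of_le (fun x _ => mem_parabolic_whole x)
      (le_iSup_of_le ⟨γ, mem_parabolic_whole γ⟩ le_rfl))

lemma IsHNPair.refines_of_eq (h : IsHNPair (quotHeight g) Q γ) {P : Composition n}
    {δ : GL (Fin n) F} (hP : ((rho P (whole n) ⬝ᵥ harishChandra P (rat δ * g) : ℝ) : EReal) =
      instabilityDegree (whole n) g) : Refines P Q ∧ δ * γ⁻¹ ∈ parabolic Q F := by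
  rw [h.instabilityDegree_eq, EReal.coe_eq_coe_iff, rho_whole_eq, rho_whole_eq, sub_left_inj] at hP
  exact h.refines_of_area_le (quotHeight_top g) (quotHeight_add_le g) hP.ge

theorem IsHNPair.isCanonical (h : IsHNPair (quotHeight g) Q γ) : IsCanonical Q γ g :=
  ⟨h.instabilityDegree_eq.symm, fun _ hle hP =>
    (h.refines_of_eq hP).1.antisymm (refines_of_parabolic_le hle)⟩

theorem IsHNPair.eq_of_isCanonical (h : IsHNPair (quotHeight g) Q γ) {P : Composition n}
    {δ : GL (Fin n) F} (hP : IsCanonical P δ g) : P = Q ∧ δ * γ⁻¹ ∈ parabolic Q F := by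
  obtain ⟨href, hδ⟩ := h.refines_of_eq hP.1
  refine ⟨(hP.2 Q href.parabolic_le ?_).symm, hδ⟩
  rw [(h.congr hδ).instabilityDegree_eq]

/-! ### Slopes at the first vertex -/

omit [NeZero n] in
lemma varpi_dotProduct (P : Composition n) (H : Fin n → ℝ) :
    varpi P ⬝ᵥ H = polygon H (firstPart P) / firstPart P := by
  rw [polygon_eq_sum_filter H (firstPart_le_self P), Finset.sum_filter, Finset.sum_div]
  refine Finset.sum_congr rfl fun i _ => ?_
  by_cases hi : (i : ℕ) < firstPart P
  · simp only [varpi, if_pos hi]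
    ring
  · simp only [varpi, if_neg hi, zero_mul, zero_div]

omit [NeZero n] in
lemma slope_eq (P : Composition n) (δ : GL (Fin n) F) (g : GL (Fin n) (Adele F)) :
    slope P δ g = quotHeight g (rowSpan δ (firstPart P)) / firstPart P := by
  rw [slope, varpi_dotProduct, harishChandra_eq, firstPart, polygon_sizeUpTo (quotHeight_top g)]

omit [NeZero n] in
lemma slope_eq_slopeAt (P : Composition n) (δ : GL (Fin n) F) (g : GL (Fin n) (Adele F)) :
    slope P δ g = slopeAt (quotHeight g) P δ 0 := by
  rw [slope_eq, slopeAt, P.sizeUpTo_zero, rowSpan_zero, quotHeight_top]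
  simp [firstPart]

/-- The line through the origin with the first Harder–Narasimhan slope bounds `f`. Extremality of
`P` plays no role. -/
lemma IsHNPair.slope_le (h : IsHNPair (quotHeight g) Q γ) (P : Composition n) (δ : GL (Fin n) F) :
    slope P δ g ≤ slope Q γ g := by
  rw [slope_eq_slopeAt Q, slope_eq]
  have hr : 0 < Q.length := Q.length_pos_iff.2 (NeZero.pos n)
  have h1 := HNChain.sub_le h (quotHeight_add_le g) (t := slopeAt (quotHeight g) Q γ 0)
    (Nat.zero_le _) (fun k hk => absurd hk (Nat.not_lt_zero k)) (fun k _ hk => by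
      rcases Nat.eq_zero_or_pos k with rfl | hk0
      · exact le_rfl
      · exact (HNChain.slope_lt h hk0 hk).le) (rowSpan δ (firstPart P))
  rw [natCast_finrank_rowSpan δ (firstPart_le_self P), natCast_finrank_rowSpan γ (Q.sizeUpTo_le 0),
    Q.sizeUpTo_zero, rowSpan_zero, quotHeight_top, Nat.cast_zero] at h1
  have hpos : (0 : ℝ) < firstPart P := by exact_mod_cast firstPart_pos P
  rw [div_le_iff₀ hpos]
  linarith

/-- A chord of maximal slope cannot pass the first vertex, whose support line has slope `t` below
the first slope. -/
lemma IsHNPair.firstPart_le (h : IsHNPair (quotHeight g) Q γ) {P : Composition n}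
    {δ : GL (Fin n) F} (hP : slope P δ g = slope Q γ g) :
    firstPart P ≤ firstPart Q ∧
      (firstPart P = firstPart Q → rowSpan δ (firstPart P) = rowSpan γ (firstPart Q)) := by
  have hr : 0 < Q.length := Q.length_pos_iff.2 (NeZero.pos n)
  obtain ⟨t, ht, ht'⟩ := HNChain.exists_support h (quotHeight_add_le g) (j := 1) hr
  change ∀ U : Submodule F (Fin n → F), quotHeight g U - quotHeight g (rowSpan γ (firstPart Q)) ≤
    t * (finrank F (rowSpan γ (firstPart Q)) - finrank F U) at ht
  change ∀ U : Submodule F (Fin n → F), t * (finrank F (rowSpan γ (firstPart Q)) - finrank F U) ≤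
    quotHeight g U - quotHeight g (rowSpan γ (firstPart Q)) → U = rowSpan γ (firstPart Q) at ht'
  rw [natCast_finrank_rowSpan γ (firstPart_le_self Q)] at ht ht'
  have hQpos : (0 : ℝ) < firstPart Q := by exact_mod_cast firstPart_pos Q
  have hPpos : (0 : ℝ) < firstPart P := by exact_mod_cast firstPart_pos P
  have hQs : quotHeight g (rowSpan γ (firstPart Q)) = slope Q γ g * firstPart Q := by
    rw [slope_eq, div_mul_cancel₀ _ hQpos.ne']
  have hPs : quotHeight g (rowSpan δ (firstPart P)) = slope Q γ g * firstPart P := by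
    rw [← hP, slope_eq, div_mul_cancel₀ _ hPpos.ne']
  -- Otherwise `⊤` would also reach the support line and coincide with the first proper term of the
  -- flag.
  have htlt : t < slope Q γ g := by
    by_contra hcon
    rw [not_lt] at hcon
    have htop := ht' ⊤ (by
      rw [quotHeight_top, hQs, finrank_top, Module.finrank_fin_fun]
      nlinarith)
    have e := congrArg (fun W : Submodule F (Fin n → F) => finrank F W) htop
    simp only [finrank_rowSpan, finrank_top, Module.finrank_fin_fun] at e
    have h1 := firstPart_pos Q
    have h2 := NeZero.pos n
    omega
  have hPU := ht (rowSpan δ (firstPart P))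
  rw [natCast_finrank_rowSpan δ (firstPart_le_self P), hPs, hQs] at hPU
  refine ⟨?_, fun heq => ht' _ ?_⟩
  · by_contra hcon
    have hlt : (firstPart Q : ℝ) < firstPart P := by exact_mod_cast not_le.1 hcon
    nlinarith
  · rw [natCast_finrank_rowSpan δ (firstPart_le_self P), hPs, hQs]
    rw [heq]
    linarith

lemma exists_isExtremal (Q : Composition n) : ∃ P : Composition n, IsExtremal P ∧
    firstPart P = firstPart Q ∧
      P.blocks = if Q.length = 1 then [n] else [firstPart Q, Q.blocks.tail.sum] := by
  by_cases hQ : Q.length = 1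
  · refine ⟨Q, Or.inl hQ, rfl, ?_⟩
    rw [if_pos hQ, (Composition.eq_single_iff_length (NeZero.pos n)).2 hQ,
      Composition.single_blocks]
  · rw [if_neg hQ]
    have hr : 0 < Q.length := Q.length_pos_iff.2 (NeZero.pos n)
    have hsum := Q.blocks_sum
    have hpos := fun i hi => Q.blocks_pos (i := i) hi
    have hfirst : firstPart Q = (Q.blocks.take 1).sum := rfl
    have hlen : Q.length = Q.blocks.length := rfl
    rw [hlen] at hQ hr
    obtain ⟨a, l, hal⟩ := List.exists_cons_of_length_pos hr
    rw [hal] at hsum hpos hfirst hQ ⊢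
    obtain ⟨b, l', rfl⟩ := List.exists_cons_of_ne_nil (l := l) (by rintro rfl; simp at hQ)
    have hb := hpos b (by simp)
    have ha := hpos a (by simp)
    have hfa : firstPart Q = a := by simpa using hfirst
    rw [hfa]
    refine ⟨⟨[a, (b :: l').sum], ?_, ?_⟩, Or.inr rfl, ?_, rfl⟩
    · intro i hi
      simp only [List.mem_cons, List.not_mem_nil, or_false, List.sum_cons] at hi
      rcases hi with rfl | rfl <;> omega
    · simpa using hsum
    · simp [firstPart, Composition.sizeUpTo]

omit [NeZero n] in
lemma IsExtremal.sizeUpTo_eq {P : Composition n} (hP : IsExtremal P) {k : ℕ} (hk : 2 ≤ k) :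
    P.sizeUpTo k = n :=
  P.sizeUpTo_ofLength_le k (by rcases hP with h | h <;> omega)

omit [NeZero n] [NumberField F] in
lemma IsExtremal.mem_parabolic {P : Composition n} (hP : IsExtremal P) {δ' δ : GL (Fin n) F}
    (h : rowSpan δ' (firstPart P) = rowSpan δ (firstPart P)) : δ' * δ⁻¹ ∈ parabolic P F := by
  refine (mem_parabolic_iff P δ' δ).2 fun k => ?_
  match k with
  | 0 => rw [P.sizeUpTo_zero, rowSpan_zero, rowSpan_zero]
  | 1 => exact h
  | k + 2 =>
    rw [hP.sizeUpTo_eq (by omega), rowSpan_of_le δ' le_rfl, rowSpan_of_le δ le_rfl]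

/-! ### The truncation function -/

omit [NeZero n] in
lemma blockMean_dotProduct (P : Composition n) (k : Fin P.length) (δ : GL (Fin n) F)
    (g : GL (Fin n) (Adele F)) :
    blockMean P k ⬝ᵥ slopeVec (quotHeight g) P δ = slopeAt (quotHeight g) P δ k := by
  have h := sum_mul_index P (fun a => if a = k then (1 / P.blocksFun k : ℝ) else 0)
    (slopeVec (quotHeight g) P δ)
  simp only [ite_mul, zero_mul, Finset.sum_ite_eq', Finset.mem_univ, if_true] at h
  rw [polygon_sizeUpTo (quotHeight_top g), polygon_sizeUpTo (quotHeight_top g)] at h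
  have h1 : blockMean P k ⬝ᵥ slopeVec (quotHeight g) P δ = ∑ i, (if P.index i = k then
      (1 / P.blocksFun k : ℝ) * slopeVec (quotHeight g) P δ i else 0) :=
    Finset.sum_congr rfl fun i _ => by
      simp only [blockMean]
      split_ifs <;> simp
  rw [h1, h, slopeAt, sizeUpTo_succ_eq]
  push_cast
  rw [add_sub_cancel_left]
  ring

omit [NeZero n] in
lemma mem_positiveCone_iff (P : Composition n) (δ : GL (Fin n) F) (g : GL (Fin n) (Adele F)) :
    harishChandra P (rat δ * g) ∈ positiveCone P ↔ ∀ k, k + 1 < P.length →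
      slopeAt (quotHeight g) P δ (k + 1) < slopeAt (quotHeight g) P δ k := by
  rw [harishChandra_eq]
  constructor
  · intro h k hk
    have := h _ ⟨⟨k, by omega⟩, ⟨k + 1, hk⟩, rfl, rfl⟩
    rw [sub_dotProduct, blockMean_dotProduct, blockMean_dotProduct] at this
    exact sub_pos.1 this
  · rintro h _ ⟨k, l, hl, rfl⟩
    rw [sub_dotProduct, blockMean_dotProduct, blockMean_dotProduct, sub_pos, hl]
    exact h k (hl ▸ l.2)

omit [NeZero n] in
-- Replacing `δ'` by `δ' * δ` turns the supremum over `P(F)` into one over flags refining that of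
-- `(P, δ)`.
lemma mem_semistableSet_iff (P : Composition n) (δ : GL (Fin n) F) (g : GL (Fin n) (Adele F)) :
    rat δ * g ∈ semistableSet F P ↔ ∀ (P' : Composition n) (δ' : GL (Fin n) F), Refines P' P →
      δ' * δ⁻¹ ∈ parabolic P F → rho P' P ⬝ᵥ slopeVec (quotHeight g) P' δ' ≤ 0 := by
  have key : ∀ δ' : GL (Fin n) F, rat δ' * (rat δ * g) = rat (δ' * δ) * g := fun δ' => by
    rw [map_mul, mul_assoc]
  simp only [semistableSet, Set.mem_ofPred_eq, instabilityDegree, iSup_le_iff, key]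
  simp only [harishChandra_eq]
  constructor
  · intro h P' δ' hP' hδ'
    have := h P' hP'.parabolic_le ⟨δ' * δ⁻¹, hδ'⟩
    simp only [inv_mul_cancel_right] at this
    exact_mod_cast this
  · intro h P' hP' δ'
    exact_mod_cast h P' (δ' * δ) (refines_of_parabolic_le hP')
      (by rw [mul_inv_cancel_right]; exact δ'.2)

omit [NeZero n] in
-- A Harder–Narasimhan flag has maximal area, so no refinement has positive degree. Conversely, a
-- subspace violating semistability of a step can be inserted to give a refinement of positive
-- degree.
theorem isHNPair_iff (P : Composition n) (δ : GL (Fin n) F) (g : GL (Fin n) (Adele F)) :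
    IsHNPair (quotHeight g) P δ ↔
      rat δ * g ∈ semistableSet F P ∧ harishChandra P (rat δ * g) ∈ positiveCone P := by
  rw [mem_semistableSet_iff, mem_positiveCone_iff]
  constructor
  · refine fun h => ⟨fun P' δ' hP' hδ' => ?_, h.decreasing⟩
    rw [hP'.rho_dotProduct_slopeVec (quotHeight_top g), slopeVec_congr hδ', sub_nonpos]
    exact h.area_le (quotHeight_top g) (quotHeight_add_le g) P' δ'
  · rintro ⟨h1, h2⟩
    refine ⟨?_, ?_, fun k l hkl => rowSpan_antitone δ (P.monotone_sizeUpTo hkl), fun k hk => ?_,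
      fun k hk => ?_, fun k hk U hU hU' => ?_, h2⟩
    · simp only [P.sizeUpTo_zero, rowSpan_zero]
    · simp only [P.sizeUpTo_length, rowSpan_of_le δ le_rfl]
    · refine lt_of_le_of_ne (rowSpan_antitone δ (P.monotone_sizeUpTo k.le_succ)) fun h => ?_
      have e := congrArg (fun W : Submodule F (Fin n → F) => finrank F W) h
      simp only [finrank_rowSpan] at e
      have h3 := P.sizeUpTo_strict_mono hk
      have h4 := P.sizeUpTo_le (k + 1)
      omega
    · rw [natCast_finrank_rowSpan δ (P.sizeUpTo_le _), natCast_finrank_rowSpan δ (P.sizeUpTo_le _),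
        ← slopeAt_mul δ hk]
      ring
    · by_contra hcon
      obtain ⟨P', δ', hP', hδ', hpos⟩ := exists_refinement_rho_pos hk hU hU' (not_le.1 hcon)
      exact absurd (h1 P' δ' hP' hδ') (not_le.2 hpos)

theorem IsHNPair.truncation_eq (h : IsHNPair (quotHeight g) Q γ) :
    truncation g = if slope Q γ g ≤ 0 then 1 else 0 := by
  classical
  have hterm : ∀ (P : Composition n) (δ : GL (Fin n) F),
      (semistableSet F P).indicator (1 : GL (Fin n) (Adele F) → ℝ≥0∞) (rat δ * g) *
      (positiveCone P).indicator 1 (harishChandra P (rat δ * g)) *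
      (slopeHalfSpace P).indicator 1 (harishChandra P (rat δ * g)) =
      if (P = Q ∧ δ * γ⁻¹ ∈ parabolic Q F) ∧ slope Q γ g ≤ 0 then 1 else 0 := by
    intro P δ
    have h1 : (P = Q ∧ δ * γ⁻¹ ∈ parabolic Q F) ↔
        rat δ * g ∈ semistableSet F P ∧ harishChandra P (rat δ * g) ∈ positiveCone P := by
      rw [← isHNPair_iff]
      constructor
      · rintro ⟨rfl, hδ⟩
        exact h.congr hδ
      · exact fun hP => h.eq_of_isCanonical hP.isCanonical
    by_cases hPQ : P = Q ∧ δ * γ⁻¹ ∈ parabolic Q F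
    · obtain ⟨h2, h3⟩ := h1.1 hPQ
      obtain ⟨rfl, hδ⟩ := hPQ
      have h4 : slope P γ g = varpi P ⬝ᵥ harishChandra P (rat δ * g) := by
        rw [slope, harishChandra_eq, harishChandra_eq, slopeVec_congr hδ]
      rw [Set.indicator_of_mem h2, Set.indicator_of_mem h3]
      simp only [Set.indicator_apply, slopeHalfSpace, Set.mem_ofPred_eq, Pi.one_apply, one_mul, h4,
        hδ, and_self, true_and]
    · rw [if_neg fun hc => hPQ hc.1]
      rw [h1, not_and_or] at hPQ
      rcases hPQ with hc | hc
      · rw [Set.indicator_of_notMem hc, zero_mul, zero_mul]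
      · rw [Set.indicator_of_notMem hc, mul_zero, zero_mul]
  simp only [truncation, hterm]
  by_cases hs : slope Q γ g ≤ 0
  · simp only [hs, and_true, if_true]
    rw [Finset.sum_eq_single Q (fun P _ hP => by simp [hP]) (by simp),
      -- The class of `γ` is the only one that contributes; its chosen representative may differ
      -- from `γ` by an element of `Q(F)`.
      tsum_eq_single (Quotient.mk (QuotientGroup.rightRel (parabolic Q F)) γ)]
    · have h1 := Quotient.mk_out (s := QuotientGroup.rightRel (parabolic Q F)) γ
      have h2 := Setoid.symm' _ h1
      rw [if_pos ⟨rfl, QuotientGroup.rightRel_apply.1 h2⟩]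
    · intro q hq
      rw [if_neg]
      rintro ⟨-, hm⟩
      refine hq ?_
      rw [← Quotient.out_eq q]
      exact (Quotient.sound (QuotientGroup.rightRel_apply.2 hm)).symm
  · simp [hs]

end Canonical

end AdelicGL

end

/-! ### The maximal slope and the truncation function -/

theorem proposition3p4p1 (F : Type*) [Field F] [NumberField F] (n : ℕ) [NeZero n]
    (g : Matrix.GeneralLinearGroup (Fin n) (AdelicGL.Adele F)) :
    -- the supremum is finite and attained
    (∃ s : ℝ, IsGreatest (AdelicGL.extremalSlopes g) s) ∧
    -- the largest extremal `P` that attains it, and its unique `δ`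
    (∃ (P : Composition n) (δ : Matrix.GeneralLinearGroup (Fin n) F),
      AdelicGL.AttainsSup P δ g ∧
      (∀ (P' : Composition n) (δ' : Matrix.GeneralLinearGroup (Fin n) F),
        AdelicGL.AttainsSup P' δ' g → AdelicGL.firstPart P' ≤ AdelicGL.firstPart P) ∧
      (∀ δ' : Matrix.GeneralLinearGroup (Fin n) F,
        AdelicGL.AttainsSup P δ' g → δ' * δ⁻¹ ∈ AdelicGL.parabolic P F) ∧
      -- the canonical pair `(Q, γ)`, the type of `P`, and `δ` as the projection of `γ`
      ∃ (Q : Composition n) (γ : Matrix.GeneralLinearGroup (Fin n) F),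
        AdelicGL.IsCanonical Q γ g ∧
        (∀ (Q' : Composition n) (γ' : Matrix.GeneralLinearGroup (Fin n) F),
          AdelicGL.IsCanonical Q' γ' g → Q' = Q ∧ γ' * γ⁻¹ ∈ AdelicGL.parabolic Q F) ∧
        P.blocks = (if Q.length = 1 then [n]
          else [AdelicGL.firstPart Q, Q.blocks.tail.sum]) ∧
        δ * γ⁻¹ ∈ AdelicGL.parabolic P F) ∧
    -- the characterization of `E^G(g) = 1`
    (AdelicGL.truncation g = 1 ↔
      ∀ (P : Composition n) (δ : Matrix.GeneralLinearGroup (Fin n) F),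
        AdelicGL.IsExtremal P → AdelicGL.slope P δ g ≤ 0) := by
  obtain ⟨Q, γ, h⟩ := AdelicGL.exists_isHNPair (AdelicGL.quotHeight_add_le g)
    (AdelicGL.quotHeight_bddAbove g)
  -- `P` merges all blocks of `Q` after the first. It keeps the first proper term of the flag of
  -- `γ`, so `γ` itself serves as `δ`.
  obtain ⟨P, hPext, hPfirst, hPblocks⟩ := AdelicGL.exists_isExtremal Q
  have hslope : AdelicGL.slope P γ g = AdelicGL.slope Q γ g := by
    rw [AdelicGL.slope_eq, AdelicGL.slope_eq, hPfirst]
  have hgreatest : IsGreatest (AdelicGL.extremalSlopes g) (AdelicGL.slope P γ g) := by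
    refine ⟨⟨P, γ, hPext, rfl⟩, ?_⟩
    rintro _ ⟨P', δ', -, rfl⟩
    rw [hslope]
    exact h.slope_le P' δ'
  have hmax : ∀ {P' : Composition n} {δ' : Matrix.GeneralLinearGroup (Fin n) F},
      AdelicGL.AttainsSup P' δ' g → AdelicGL.slope P' δ' g = AdelicGL.slope Q γ g :=
    fun hP' => (hP'.2.unique hgreatest).trans hslope
  refine ⟨⟨_, hgreatest⟩, ⟨P, γ, ⟨hPext, hgreatest⟩, fun P' δ' hP' => ?_, fun δ' hδ' => ?_,
    Q, γ, h.isCanonical, fun Q' γ' => h.eq_of_isCanonical, hPblocks, ?_⟩, ?_⟩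
  · rw [hPfirst]
    exact (h.firstPart_le (hmax hP')).1
  · refine hPext.mem_parabolic ?_
    rw [(h.firstPart_le (hmax hδ')).2 hPfirst, hPfirst]
  · rw [mul_inv_cancel]
    exact one_mem _
  · rw [h.truncation_eq]
    constructor
    · intro hE P' δ' _
      by_contra hcon
      rw [if_neg fun hs => hcon ((h.slope_le P' δ').trans hs)] at hE
      exact zero_ne_one hE
    · exact fun hle => if_pos (hslope ▸ hle P γ hPext)
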